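/- Let $n\ge 1$, let $H^*$ be the Euclidean space with orthonormal basis $\epsilon_1,\dots,\epsilon_n$ and bilinear form $(\cdot,\cdot)$, and consider the root data of $osp(1|2n)$: even positive roots $\Phi_0^+=\{\epsilon_i\pm\epsilon_j\ (i<j),\ 2\epsilon_k\}$, odd positive roots $\Phi_1^+=\{\epsilon_k\}$, $2\rho=\sum_{\alpha\in\Phi_0^+}\alpha-\sum_{\beta\in\Phi_1^+}\beta$, $\phi_0=\{\alpha\in\Phi_0^+:\alpha/2\notin\Phi_1^+\}$, $\phi_1=\Phi_1^+$. Let $W$ be the Weyl group (all signed permutations of the $\epsilon_i$), $\tau$ its maximal element, and let $\epsilon'(\sigma)=-1$ if an odd number of the reflections composing $\sigma$ are in elements of $\phi_0$, and $\epsilon'(\sigma)=1$ otherwise. Let $X=\sum_i\mathbb Z_{\ge0}\,\epsilon_i$, $X_M=X/MX$ (with representatives $\{0,\dots,M-1\}^n$), and $[\lambda]=\sum_i\lambda_i \bmod 2$ for $\lambda=\sum_i\lambda_i\epsilon_i\in X$. For even $N$ let $q=\exp(2\pi i/N)$ and $q^x=\exp(2\pi i x/N)$. Put $\phi=\phi_0\cup\phi_1$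 if $N\equiv2\pmod 4$ and $\phi=\phi_0$ if $N\equiv 0\pmod 4$. For $n\ge2$ let $\Lambda_N^+=\{\lambda\in X: 0<2(\lambda+\rho,\alpha)/(\alpha,\alpha)<N/2\ \ \forall\alpha\in\phi\}$; for $n=1$ let $\Lambda_N^+=\{\lambda\in X:0<(\lambda+\rho,\epsilon_1)<N''\}$ with $N''=N/4$ if $N\equiv2\pmod4$ and $N''=N/2$ if $N\equiv 0\pmod 4$. Put $$S'_{\lambda,\mu}=\sum_{\sigma\in W}\epsilon'(\sigma)q^{2(\lambda+\rho,\sigma(\mu+\rho))},\quad S_{\lambda,\mu}=(-1)^{[\lambda]}S'_{\lambda,\mu},\quad Q_\mu=\sum_{\sigma\in W}\epsilon'(\sigma)q^{2(\rho,\sigma(\mu+\rho))},$$ and $\chi_\mu(v)=q^{-(\mu,\mu+2\rho)}$. At generic $q$ (not a root of unity) the central element $C_\lambda$ of $U_q(osp(1|2n))$ acts on the irreducible module of highest weight $\mu$ by the scalar $sch_\lambda(q^{2(\mu+\rho)})=S_{\lambda,\mu}/Q_\mu$, and that of highest weight $\lambda$ has quantum superdimension $sch_\lambda(q^{2\rho})=S_{\lambda,0}/Q_0$.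 Write $\chi_\mu(C_\lambda)$ and $\mathrm{sdim}_q(V_\lambda)$ for the limits of these two expressions as the parameter tends to $\exp(2\pi i/N)$ through generic values, and $\gamma=Q_0$, taken at $q=\exp(2\pi i/N)$, for the denominator in the expression of the quantum superdimension. A family $(d_\lambda)_{\lambda\in\Lambda_N^+}$ of complex numbers satisfies condition (iv) if at least one $d_\lambda$ is nonzero and $\delta=v-\sum_{\lambda\in\Lambda_N^+}d_\lambda\chi_\lambda(v^{-1})C_\lambda$ acts as zero on every $V_\mu$, $\mu\in\Lambda_N^+$, that is, $$\chi_\mu(v)=\sum_{\lambda\in\Lambda_N^+}d_\lambda\,\chi_\lambda(v)^{-1}\,\chi_\mu(C_\lambda)\qquad\text{for all }\mu\in\Lambda_N^+ .$$ **(a)** Let $N=2(2k+1)$, $k\ge 0$. Then: 1. For $\lambda,\mu\in\Lambda_N^+$ the limits defining $\chi_\mu(C_\lambda)$ and $\mathrm{sdim}_q(V_\lambda)$ exist. 2. $q^{(\mu,\mu+2\rho)}$ depends only on the class of $\mu\in X$ in $X_{N/2}$, and $$0\ne\sum_{\mu\in X_{N/2}}q^{(\mu,\mu+2\rho)}=2^{-n}\sum_{\mu\in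 X_N}q^{(\mu,\mu+2\rho)},\qquad \sum_{\mu\in X_N}q^{(\mu,\mu+2\rho)}=\prod_{j=0}^{n-1}G(N,2j+1),$$ where $G(N,m)=\sum_{i=0}^{N-1}q^{i(i+m)}$; moreover there is a primitive $4N$-th root of unity $x$ such that $G(N,m)=(1+i)\sqrt N/x^{m^2}$ for all odd $m\ge1$. 3. If $\Lambda_N^+\neq\emptyset$, then condition (iv) holds with $$d_\lambda=q^{(2\rho,\rho)}\,\gamma\,\mathrm{sdim}_q(V_\lambda)\Big/\sum_{\mu\in X_{N/2}}q^{(\mu,\mu+2\rho)} .$$ 4. For $\lambda\in\Lambda_N^+$ the weight $\lambda^*=-\tau(\lambda)$ lies in $\Lambda_N^+$ and $d_{\lambda^*}=d_\lambda$. 5. With $c^{-1}=\sum_{\lambda\in X_N}q^{(\lambda,\lambda+2\rho)}$, the numbers $x_\lambda=c\,q^{-(\lambda,2\rho)}$ $(\lambda\in X_N)$ satisfy, for all $\mu\in\Lambda_N^+$, $$Q_\mu\,q^{-(\mu,\mu+2\rho)}=\sum_{\lambda\in X_N}x_\lambda\,q^{(\lambda,\lambda+2\rho)}S'_{\lambda,\mu}.\tag{$*$}$$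 **(b)** Let $N=4k$, $k\ge1$. Then the same choice fails: $q^{(\lambda',\lambda'+2\rho)}=-q^{(\lambda,\lambda+2\rho)}$ for $\lambda'=\lambda+\tfrac N2\epsilon_i$ (so $q^{(\mu,\mu+2\rho)}$ is not a function on $X_{N/2}$); $\sum_{\mu\in X_N}q^{(\mu,\mu+2\rho)}=0$, and also $\sum_{\mu\in\{0,\dots,N/2-1\}^n}q^{(\mu,\mu+2\rho)}=0$; and for no $c\in\mathbb C$ and no $\mu\in\Lambda_N^+$ does $x_\lambda=c\,q^{-(\lambda,2\rho)}$ satisfy $(*)$. -/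

import Mathlib

open Filter Topology

noncomputable section

/-! ## Euclidean data of `osp(1|2n)` -/

/-- The Euclidean space `H^*` with its orthonormal basis `ε_i = Pi.single i 1` (indexed from `0`);
its bilinear form `(x, y)` is the dot product `x ⬝ᵥ y`. -/
abbrev HDual (n : ℕ) : Type := Fin n → ℝ

/-- The basis vector `ε_i`. -/
def eps {n : ℕ} (i : Fin n) : HDual n := Pi.single i 1

open Classical in
/-- The even positive roots `ε_i ± ε_j` (`i < j`) and `2 ε_k`. -/
def evenRoots (n : ℕ) : Finset (HDual n) :=
  ((Finset.univ.filter fun p : Fin n × Fin n => p.1 < p.2).image fun p => eps p.1 - eps p.2) ∪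
  ((Finset.univ.filter fun p : Fin n × Fin n => p.1 < p.2).image fun p => eps p.1 + eps p.2) ∪
  (Finset.univ.image fun k : Fin n => (2 : ℝ) • eps k)

open Classical in
/-- The odd positive roots `ε_i`. -/
def oddRoots (n : ℕ) : Finset (HDual n) := Finset.univ.image fun k : Fin n => eps k

/-- `ρ`, half of (sum of even positive roots) minus (sum of odd positive roots). -/
def rho (n : ℕ) : HDual n :=
  (1 / 2 : ℝ) • (∑ α ∈ evenRoots n, α - ∑ β ∈ oddRoots n, β)

open Classical in
/-- `φ_0`: the even positive roots whose half is not an odd root. -/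
def phiZero (n : ℕ) : Finset (HDual n) :=
  (evenRoots n).filter fun δ => (1 / 2 : ℝ) • δ ∉ oddRoots n

/-- `φ_1`: the odd positive roots. -/
def phiOne (n : ℕ) : Finset (HDual n) := oddRoots n

open Classical in
/-- `φ = φ_0 ∪ φ_1` if `N ≡ 2 (mod 4)`, and `φ = φ_0` otherwise. -/
def phi (N n : ℕ) : Finset (HDual n) :=
  if N % 4 = 2 then phiZero n ∪ phiOne n else phiZero n

/-- `X = ∑ ℤ_+ ε_i`. -/
abbrev Weight (n : ℕ) : Type := Fin n → ℕ

/-- The inclusion of `X` into `H^*`. -/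
def Weight.toH {n : ℕ} (lam : Weight n) : HDual n := fun i => (lam i : ℝ)

/-- `N' = N` for odd `N` and `N' = N / 2` otherwise. -/
def NPrime (N : ℕ) : ℝ := if Odd N then (N : ℝ) else (N : ℝ) / 2

/-- `N'' = N / 4` if `N ≡ 2 (mod 4)` and `N'' = N'` otherwise. -/
def NDoublePrime (N : ℕ) : ℝ := if N % 4 = 2 then (N : ℝ) / 4 else NPrime N

/-- The index set `Λ_N^+` (strict inequalities). -/
def LambdaPlus (N n : ℕ) : Set (Weight n) :=
  if n = 1 then
    {lam | ∀ α ∈ oddRoots n,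
      0 < (lam.toH + rho n) ⬝ᵥ α ∧ (lam.toH + rho n) ⬝ᵥ α < NDoublePrime N}
  else
    {lam | ∀ α ∈ phi N n,
      0 < 2 * ((lam.toH + rho n) ⬝ᵥ α) / (α ⬝ᵥ α) ∧
        2 * ((lam.toH + rho n) ⬝ᵥ α) / (α ⬝ᵥ α) < NPrime N}

/-! ## The Weyl group -/

/-- The Weyl group of `osp(1|2n)`: all signed permutations of the `ε_i`. -/
abbrev Weyl (n : ℕ) : Type := (Fin n → ℤˣ) × Equiv.Perm (Fin n)

/-- The action on `H^*`: `ε_i` is sent to `± ε_{π i}`, with the sign attached to `π i`. -/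
def Weyl.act {n : ℕ} (w : Weyl n) (x : HDual n) : HDual n :=
  fun i => (((w.1 i : ℤˣ) : ℤ) : ℝ) * x (w.2⁻¹ i)

/-- `ε'(σ) = -1` if an odd number of the reflections composing `σ` are in elements of `φ_0`, and
`ε'(σ) = 1` otherwise.  The reflections in `ε_i ± ε_j` transpose `i` and `j`, those in `ε_i` only
change a sign, so this is the sign of the underlying permutation; see `Weyl.reflection_mem` and
`Weyl.act_comp`. -/
def Weyl.epsPrime {n : ℕ} (w : Weyl n) : ℤ := ((Equiv.Perm.sign w.2 : ℤˣ) : ℤ)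

/-- `τ` is the maximal (longest) element: it sends every positive root to a negative one. -/
def Weyl.IsMaximal {n : ℕ} (τ : Weyl n) : Prop :=
  (∀ α ∈ evenRoots n, -τ.act α ∈ evenRoots n) ∧ ∀ α ∈ oddRoots n, -τ.act α ∈ oddRoots n

/-! ## Powers of `q` and characters

A value of the quantum parameter is written `q = exp(2πi t)`, and `q^x` means `exp(2πi t x)`.
The root of unity `q = exp(2πi / N)` is `t = 1 / N`. -/

/-- `q^x` for `q = exp(2πi t)`. -/
def qpow (t : ℂ) (x : ℝ) : ℂ := Complex.exp (2 * Real.pi * Complex.I * t * x)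

/-- The parameter of `q = exp(2πi / N)`. -/
def rootParam (N : ℕ) : ℂ := 1 / (N : ℂ)

/-- `q → exp(2πi / N)` through generic values, that is, values that are not roots of unity. -/
def genericLimit (N : ℕ) : Filter ℂ :=
  𝓝[{t : ℂ | ∀ m : ℕ, 0 < m → qpow t 1 ^ m ≠ 1}] (rootParam N)

/-- `(-1)^{[λ]}`, where the parity `[λ]` is that of `∑ λ_i`. -/
def parSign {n : ℕ} (lam : Weight n) : ℂ := (-1) ^ (∑ i, lam i)

/-- `S'_{λ,μ} = ∑_σ ε'(σ) q^{2(λ+ρ, σ(μ+ρ))}`. -/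
def SPrime {n : ℕ} (t : ℂ) (lam mu : Weight n) : ℂ :=
  ∑ w : Weyl n, (w.epsPrime : ℂ) *
    qpow t (2 * ((lam.toH + rho n) ⬝ᵥ w.act (mu.toH + rho n)))

/-- `S_{λ,μ} = (-1)^{[λ]} S'_{λ,μ}`. -/
def SMat {n : ℕ} (t : ℂ) (lam mu : Weight n) : ℂ := parSign lam * SPrime t lam mu

/-- `Q_μ = ∑_σ ε'(σ) q^{2(ρ, σ(μ+ρ))}`. -/
def QDen {n : ℕ} (t : ℂ) (mu : Weight n) : ℂ :=
  ∑ w : Weyl n, (w.epsPrime : ℂ) * qpow t (2 * (rho n ⬝ᵥ w.act (mu.toH + rho n)))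

/-- The supercharacter value `sch_λ(q^{2(μ+ρ)}) = S_{λ,μ} / Q_μ`: the eigenvalue of `C_λ` in the
irreducible module of highest weight `μ` at generic `q`. -/
def sch {n : ℕ} (t : ℂ) (lam mu : Weight n) : ℂ := SMat t lam mu / QDen t mu

/-- The quantum superdimension `sch_λ(q^{2ρ})` of the irreducible module of highest weight `λ` at
generic `q`. -/
def sdimGen {n : ℕ} (t : ℂ) (lam : Weight n) : ℂ := sch t lam 0

/-- The scalar `χ_μ(C_λ)` by which `C_λ` acts on `V_μ` at `q = exp(2πi / N)`: the limit of the
generic eigenvalue. -/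
def chiC (N : ℕ) {n : ℕ} (lam mu : Weight n) : ℂ :=
  limUnder (genericLimit N) fun t => sch t lam mu

/-- `sdim_q(V_λ)` at `q = exp(2πi / N)`: the limit of the generic quantum superdimension. -/
def sdim (N : ℕ) {n : ℕ} (lam : Weight n) : ℂ :=
  limUnder (genericLimit N) fun t => sdimGen t lam

/-- `γ`, the denominator in the expression of the quantum superdimension. -/
def gammaDen (N n : ℕ) : ℂ := QDen (rootParam N) (0 : Weight n)

/-- `q^{(μ, μ + 2ρ)}` at `q = exp(2πi / N)`. -/
def qCas (N : ℕ) {n : ℕ} (mu : Weight n) : ℂ :=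
  qpow (rootParam N) (mu.toH ⬝ᵥ (mu.toH + (2 : ℝ) • rho n))

/-- `χ_μ(v) = q^{-(μ, μ + 2ρ)}` at `q = exp(2πi / N)`. -/
def chiV (N : ℕ) {n : ℕ} (mu : Weight n) : ℂ :=
  qpow (rootParam N) (-(mu.toH ⬝ᵥ (mu.toH + (2 : ℝ) • rho n)))

/-! ## Condition (iv), Gauss sums and the constants `d_λ` -/

/-- Condition (iv): some `d_λ` is nonzero, and `δ = v - ∑_λ d_λ χ_λ(v⁻¹) C_λ` acts as zero on
every `V_μ` with `μ ∈ Λ_N^+`. -/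
def ConditionIV (N n : ℕ) (d : Weight n → ℂ) : Prop :=
  (∃ lam ∈ LambdaPlus N n, d lam ≠ 0) ∧
  ∀ mu ∈ LambdaPlus N n,
    chiV N mu - ∑ᶠ lam ∈ LambdaPlus N n, d lam * (chiV N lam)⁻¹ * chiC N lam mu = 0

/-- The representative in `{0, …, M-1}^n` of an element of `X_M = X / M X`. -/
def XMod.rep {M n : ℕ} (a : Fin n → Fin M) : Weight n := fun i => (a i : ℕ)

/-- `∑_{μ ∈ X_M} q^{(μ, μ + 2ρ)}` at `q = exp(2πi / N)`, over the standard representatives. -/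
def casSum (N M n : ℕ) : ℂ := ∑ a : Fin n → Fin M, qCas N (XMod.rep a)

/-- The Gauss sum `G(N, m) = ∑_{i=0}^{N-1} q^{i(i+m)}` at `q = exp(2πi / N)`. -/
def gaussG (N m : ℕ) : ℂ := ∑ i ∈ Finset.range N, qpow (rootParam N) ((i : ℝ) * (i + m))

/-- `d_λ = q^{(2ρ,ρ)} γ sdim_q(V_λ) / ∑_{μ ∈ X_{N/2}} q^{(μ, μ + 2ρ)}`. -/
def dConst (N : ℕ) {n : ℕ} (lam : Weight n) : ℂ :=
  qpow (rootParam N) (((2 : ℝ) • rho n) ⬝ᵥ rho n) * gammaDen N n * sdim N lam /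
    casSum N (N / 2) n

/-- The choice `x_λ = c q^{-(λ, 2ρ)}`, `λ ∈ X_N`, solves the unfolded form of condition (iv) at `μ`:
`Q_μ q^{-(μ, μ + 2ρ)} = ∑_{λ ∈ X_N} x_λ q^{(λ, λ + 2ρ)} S'_{λ,μ}`. -/
def UnfoldedSolves (N : ℕ) {n : ℕ} (c : ℂ) (mu : Weight n) : Prop :=
  QDen (rootParam N) mu * chiV N mu =
    ∑ a : Fin n → Fin N,
      (c * qpow (rootParam N) (-((XMod.rep a).toH ⬝ᵥ ((2 : ℝ) • rho n)))) *
        qCas N (XMod.rep a) * SPrime (rootParam N) (XMod.rep a) mu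

end

/-! ## Checks of the Weyl group data -/

/-- The orthogonal reflection of `H^*` in `α`. -/
noncomputable def rootReflection {n : ℕ} (α x : HDual n) : HDual n :=
  x - (2 * (x ⬝ᵥ α) / (α ⬝ᵥ α)) • α

theorem Weyl.act_comp {n : ℕ} (w w' : Weyl n) :
    ∃ u : Weyl n, (∀ x, u.act x = w.act (w'.act x)) ∧
      u.epsPrime = w.epsPrime * w'.epsPrime := by
  refine ⟨(fun i => w.1 i * w'.1 (w.2⁻¹ i), w.2 * w'.2), fun x => ?_, ?_⟩
  · funext i
    simp [Weyl.act, mul_assoc]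
  · simp [Weyl.epsPrime]

theorem mem_oddRoots {n : ℕ} {α : HDual n} : α ∈ oddRoots n ↔ ∃ k, eps k = α := by
  simp [oddRoots]

theorem mem_evenRoots {n : ℕ} {α : HDual n} : α ∈ evenRoots n ↔
    (∃ i j, i < j ∧ eps i - eps j = α) ∨ (∃ i j, i < j ∧ eps i + eps j = α) ∨
      ∃ k, (2 : ℝ) • eps k = α := by
  simp [evenRoots, or_assoc]

theorem mem_phiZero {n : ℕ} {α : HDual n} : α ∈ phiZero n ↔
    (∃ i j, i < j ∧ eps i - eps j = α) ∨ (∃ i j, i < j ∧ eps i + eps j = α) := by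
  rw [phiZero, Finset.mem_filter, mem_evenRoots, mem_oddRoots]
  constructor
  · rintro ⟨h | h | ⟨k, rfl⟩, h2⟩
    · exact Or.inl h
    · exact Or.inr h
    · exact absurd ⟨k, by simp [smul_smul]⟩ h2
  · rintro (⟨i, j, hij, rfl⟩ | ⟨i, j, hij, rfl⟩)
    · refine ⟨Or.inl ⟨i, j, hij, rfl⟩, ?_⟩
      rintro ⟨k, hk⟩
      have h := congrFun hk j
      by_cases hkj : j = k
      · subst hkj; simp [eps, hij.ne'] at h; norm_num at h
      · simp [eps, hij.ne', hkj] at h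
    · refine ⟨Or.inr (Or.inl ⟨i, j, hij, rfl⟩), ?_⟩
      rintro ⟨k, hk⟩
      have h1 := congrFun hk i
      by_cases hki : i = k
      · subst hki; simp [eps, hij.ne] at h1
      · simp [eps, hij.ne, hki] at h1

/-- Reflections in `φ_0` are signed permutations with `ε' = -1`. -/
theorem Weyl.reflection_mem {n : ℕ} {α : HDual n} (hα : α ∈ phiZero n) :
    ∃ w : Weyl n, w.act = rootReflection α ∧ w.epsPrime = -1 := by
  rcases mem_phiZero.1 hα with ⟨i, j, hij, rfl⟩ | ⟨i, j, hij, rfl⟩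
  · refine ⟨(1, Equiv.swap i j), ?_, by simp [Weyl.epsPrime, Equiv.Perm.sign_swap hij.ne]⟩
    funext x l
    by_cases h1 : l = i
    · subst h1
      simp [Weyl.act, rootReflection, eps, sub_dotProduct, dotProduct_sub, hij.ne, hij.ne']; ring
    by_cases h2 : l = j
    · subst h2
      simp [Weyl.act, rootReflection, eps, sub_dotProduct, dotProduct_sub, hij.ne, hij.ne']; ring
    simp [Weyl.act, rootReflection, eps, h1, h2, Equiv.swap_apply_of_ne_of_ne]
  · refine ⟨(fun l => if l = i ∨ l = j then -1 else 1, Equiv.swap i j), ?_,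
      by simp [Weyl.epsPrime, Equiv.Perm.sign_swap hij.ne]⟩
    funext x l
    by_cases h1 : l = i
    · subst h1
      simp [Weyl.act, rootReflection, eps, add_dotProduct, dotProduct_add, hij.ne, hij.ne']; ring
    by_cases h2 : l = j
    · subst h2
      simp [Weyl.act, rootReflection, eps, add_dotProduct, dotProduct_add, hij.ne, hij.ne']; ring
    simp [Weyl.act, rootReflection, eps, h1, h2, Equiv.swap_apply_of_ne_of_ne]

/-- Reflections in odd roots are signed permutations with `ε' = 1`. -/
theorem Weyl.reflection_mem_odd {n : ℕ} {α : HDual n} (hα : α ∈ phiOne n) :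
    ∃ w : Weyl n, w.act = rootReflection α ∧ w.epsPrime = 1 := by
  obtain ⟨k, rfl⟩ := mem_oddRoots.1 hα
  refine ⟨(fun l => if l = k then -1 else 1, 1), ?_, by simp [Weyl.epsPrime]⟩
  funext x l
  by_cases h : l = k
  · subst h
    simp [Weyl.act, rootReflection, eps]; ring
  · simp [Weyl.act, rootReflection, eps, h]

theorem eps_sum_apply {n : ℕ} (l : Fin n) : (∑ k : Fin n, eps k) l = 1 := by
  simp [eps, Finset.sum_apply, Pi.single_apply]

theorem eps_injective {n : ℕ} : Function.Injective (eps : Fin n → HDual n) := by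
  intro a b h
  by_contra hab
  have := congrFun h a
  simp [eps, hab] at this

/-- The coordinates of `ρ` are `n - 1/2, …, 3/2, 1/2`. -/
theorem rho_apply {n : ℕ} (l : Fin n) : rho n l = (n : ℝ) - (l : ℕ) - 1 / 2 := by
  classical
  have hodd : (∑ β ∈ oddRoots n, β) l = 1 := by
    rw [oddRoots, Finset.sum_image fun a _ b _ h => eps_injective h]
    exact eps_sum_apply l
  have heps : ∀ i j : Fin n, (eps i : HDual n) j = if j = i then 1 else 0 := by
    intro i j; simp [eps, Pi.single_apply]
  have dot1 : ∀ {i j : Fin n}, i < j → (eps i - eps j : HDual n) ⬝ᵥ (fun _ => 1) = 0 := by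
    intro i j _; simp [eps, sub_dotProduct]
  have dot2 : ∀ {i j : Fin n}, (eps i + eps j : HDual n) ⬝ᵥ (fun _ => 1) = 2 := by
    intro i j; simp [eps, add_dotProduct]; norm_num
  have inj1 : ∀ p ∈ Finset.univ.filter (fun p : Fin n × Fin n => p.1 < p.2),
      ∀ p' ∈ Finset.univ.filter (fun p : Fin n × Fin n => p.1 < p.2),
      (eps p.1 - eps p.2 : HDual n) = eps p'.1 - eps p'.2 → p = p' := by
    rintro ⟨a, b⟩ hab ⟨c, d⟩ hcd h
    simp only [Finset.mem_filter, Finset.mem_univ, true_and] at hab hcd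
    have ha := congrFun h a
    have hb := congrFun h b
    simp only [Pi.sub_apply, heps, hab.ne, hab.ne', if_true, if_false] at ha hb
    have h1 : a = c := by
      by_contra hh; rw [if_neg hh] at ha; split_ifs at ha <;> norm_num at ha
    have h2 : b = d := by
      by_contra hh; rw [if_neg hh] at hb; split_ifs at hb <;> norm_num at hb
    rw [h1, h2]
  have inj2 : ∀ p ∈ Finset.univ.filter (fun p : Fin n × Fin n => p.1 < p.2),
      ∀ p' ∈ Finset.univ.filter (fun p : Fin n × Fin n => p.1 < p.2),
      (eps p.1 + eps p.2 : HDual n) = eps p'.1 + eps p'.2 → p = p' := by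
    rintro ⟨a, b⟩ hab ⟨c, d⟩ hcd h
    simp only [Finset.mem_filter, Finset.mem_univ, true_and] at hab hcd
    have ha := congrFun h a
    have hb := congrFun h b
    simp only [Pi.add_apply, heps, hab.ne, hab.ne', if_true, if_false] at ha hb
    have h1 : a = c ∨ a = d := by
      by_contra hh; push Not at hh; rw [if_neg hh.1, if_neg hh.2] at ha; norm_num at ha
    have h2 : b = c ∨ b = d := by
      by_contra hh; push Not at hh; rw [if_neg hh.1, if_neg hh.2] at hb; norm_num at hb
    have : a = c ∧ b = d := by
      rcases h1 with rfl | rfl <;> rcases h2 with rfl | rfl <;> simp_all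
      exact absurd hab (not_lt.2 hcd.le)
    rw [this.1, this.2]
  have heven : (∑ α ∈ evenRoots n, α) l = 2 * ((n : ℝ) - (l : ℕ)) := by
    rw [evenRoots, Finset.sum_union, Finset.sum_union, Finset.sum_image inj1,
      Finset.sum_image inj2, Finset.sum_image, ← Finset.sum_add_distrib]
    · have e : ∀ p : Fin n × Fin n, (eps p.1 - eps p.2 : HDual n) + (eps p.1 + eps p.2) =
          (2 : ℝ) • eps p.1 := fun p => by rw [two_smul]; abel
      simp only [e, Pi.add_apply, Finset.sum_apply, Pi.smul_apply, heps, smul_eq_mul]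
      rw [Finset.sum_filter, ← Finset.univ_product_univ, Finset.sum_product,
        Finset.sum_eq_single l]
      · have : ∑ y : Fin n, (if l < y then (2 : ℝ) * (if l = l then 1 else 0) else 0) =
            2 * ((n : ℝ) - 1 - (l : ℕ)) := by
          rw [← Finset.sum_filter]
          have hc : (Finset.univ.filter fun y : Fin n => l < y).card = n - 1 - l := by
            rw [← Fin.card_Ioi]; congr 1; ext; simp
          have hl := l.2
          simp [hc]
          rw [Nat.cast_sub (by omega), Nat.cast_sub (by omega)]
          push_cast; ring
        rw [this]
        simp; ring
      · intro b _ hb; simp [hb.symm]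
      · simp
    · intro a _ b _ h
      exact eps_injective (smul_right_injective _ (two_ne_zero' ℝ) h)
    · rw [Finset.disjoint_left]
      intro x h1 h2
      simp only [Finset.mem_image, Finset.mem_filter, Finset.mem_univ, true_and,
        Prod.exists] at h1 h2
      obtain ⟨a, b, hab, rfl⟩ := h1
      obtain ⟨c, d, hcd, h⟩ := h2
      have := congrArg (fun v => v ⬝ᵥ (fun _ : Fin n => (1 : ℝ))) h
      simp only [dot1 hab, dot2] at this
      norm_num at this
    · rw [Finset.disjoint_left]
      intro x h1 h2
      simp only [Finset.mem_union, Finset.mem_image, Finset.mem_filter, Finset.mem_univ, true_and,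
        Prod.exists] at h1 h2
      obtain ⟨c, rfl⟩ := h2
      rcases h1 with ⟨a, b, hab, h⟩ | ⟨a, b, hab, h⟩
      · have := congrFun h b
        simp only [Pi.sub_apply, Pi.smul_apply, heps, hab.ne', if_true, if_false] at this
        split_ifs at this <;> norm_num at this
      · have := congrFun h a
        simp only [Pi.add_apply, Pi.smul_apply, heps, hab.ne, if_true, if_false] at this
        split_ifs at this <;> norm_num at this
  simp only [rho, Pi.smul_apply, Pi.sub_apply, hodd, heven, smul_eq_mul]
  ring

/-- `Λ_N^+` is finite, so the sums over it are genuine finite sums. -/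
theorem LambdaPlus_finite (N n : ℕ) : (LambdaPlus N n).Finite := by
  have hN : NPrime N ≤ N := by
    unfold NPrime; split_ifs
    · exact le_rfl
    · have : (0 : ℝ) ≤ N := Nat.cast_nonneg N
      linarith
  have hN2 : NDoublePrime N ≤ N := by
    unfold NDoublePrime; split_ifs
    · have : (0 : ℝ) ≤ N := Nat.cast_nonneg N
      linarith
    · exact hN
  -- a common real bound for the coordinates
  obtain ⟨B, hB⟩ : ∃ B : ℕ, ∀ i : Fin n, (N : ℝ) - rho n i ≤ B := by
    obtain ⟨B, hB⟩ := exists_nat_ge (∑ i : Fin n, |(N : ℝ) - rho n i|)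
    refine ⟨B, fun i => le_trans (le_abs_self _) (le_trans ?_ hB)⟩
    exact Finset.single_le_sum (f := fun i => |(N : ℝ) - rho n i|)
      (fun _ _ => abs_nonneg _) (Finset.mem_univ i)
  refine (Set.finite_Iic (fun _ : Fin n => B)).subset fun lam hlam i => ?_
  suffices h : (lam i : ℝ) + rho n i ≤ N by
    have := hB i
    exact_mod_cast (by linarith : (lam i : ℝ) ≤ B)
  unfold LambdaPlus at hlam
  split_ifs at hlam with h1
  · have := (hlam (eps i) (mem_oddRoots.2 ⟨i, rfl⟩)).2
    simp [eps, Weight.toH] at this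
    linarith
  · -- another index exists
    have key : ∀ a b : Fin n, a < b →
        (0 < (lam a + rho n a) - (lam b + rho n b) ∧ (lam a + rho n a) - (lam b + rho n b) < N) ∧
        (0 < (lam a + rho n a) + (lam b + rho n b) ∧
          (lam a + rho n a) + (lam b + rho n b) < N) := by
      intro a b hab
      have hm : eps a - eps b ∈ phi N n := by
        have := mem_phiZero.2 (Or.inl ⟨a, b, hab, rfl⟩ : _ ∨ _)
        unfold phi; split_ifs <;> simp [this]
      have hp : eps a + eps b ∈ phi N n := by
        have := mem_phiZero.2 (Or.inr ⟨a, b, hab, rfl⟩ : _ ∨ _)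
        unfold phi; split_ifs <;> simp [this]
      have e1 := hlam _ hm
      have e2 := hlam _ hp
      simp [eps, dotProduct_sub, sub_dotProduct, hab.ne, hab.ne', Weight.toH] at e1
      simp [eps, dotProduct_add, add_dotProduct, hab.ne, hab.ne', Weight.toH] at e2
      refine ⟨⟨?_, ?_⟩, ?_, ?_⟩ <;> linarith [e1.1, e1.2, e2.1, e2.2]
    have : ∃ j : Fin n, j ≠ i := by
      have hi := i.2
      by_cases h0 : (i : ℕ) = 0
      · exact ⟨⟨1, by omega⟩, fun h => by simp [Fin.ext_iff, h0] at h⟩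
      · exact ⟨⟨0, by omega⟩, fun h => h0 (by simp [← h])⟩
    obtain ⟨j, hj⟩ := this
    rcases lt_or_gt_of_ne hj with h | h
    · have := key j i h; linarith [this.1.1, this.2.2]
    · have := key i j h; linarith [this.1.2, this.2.2]

/-!
Write `a = λ + ρ`, `b = μ + ρ`; their coordinates are half odd integers, and those of `ρ` are
`n - 1/2, …, 1/2`.

*Determinants.* `W` consists of sign changes and permutations, and `ε'` is the sign of the
permutation. Summing over the sign changes first gives `S'_{λ,μ} = det (C(a_i, b_j))` with
`C(a, b) = q^{2ab} + q^{-2ab}`, and `Q_μ` is the case `a = ρ` (`sum_weyl_eq_det`). With `z_j = q^{b_j}`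
the rows of `Q_μ` are `z^(2m+1) + z^(-2m-1)`, that is, `z + z⁻¹` times a monic polynomial of degree
`m` in `z² + z⁻²`; hence `Q_μ` is a Vandermonde determinant, nonzero on the alcove
(`QDen_ne_zero`), and the generic expressions are continuous at `exp(2πi / N)`.

*Gauss sums.* Completing the square gives `G(N, 2b) = q^{1/4 - b²} G(N, 1)` for half odd `b`, whatever
`N` is (`sum_qpow_half_odd`). If `4 ∣ N`, the summand of `G(N, 1)` changes sign under a shift by `N / 2`
and `G(N, 1) = 0`. If `N = 2M` with `M` odd, `G(N, 1)` is, up to a factor, twice a quadratic Gauss sum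
modulo `M`, and `G(N, 1) ^ 4 = -4 N² / q` (`gaussG_one_pow_four`). The determination of the sign of
the Gauss sum is not needed: `x = (1 + i)√N / G(N, 1)` satisfies `x ^ 4 = q`, and every such `x` is a
primitive `4N`-th root of unity.

*The unfolded equation.* Each row of `det (C(λ_i + ρ_i, b_j))` depends on a single coordinate of `λ`, so
the sum over `X_N` is a determinant of one-dimensional Gauss sums, which is
`∏_j q^{1/4 - b_j²} G(N, 1) · Q_μ` (`sum_unfolded`). This proves the equation if `M` is odd, and
refutes it if `4 ∣ N`, where it reads `Q_μ q^{-(μ, μ + 2ρ)} = 0`.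

*Condition (iv).* For `N = 2(2k+1)`, `Λ_N^+` corresponds to the strictly decreasing sequences
in `{1/2, …, k - 1/2}`. So the sum of `q^{(a, a)} S'_{λ,0} S'_{λ,μ}` over it is, by the Cauchy–Binet
formula (`det_mul_eq_sum_strictMono`), the determinant of the sums
`∑_a q^{a²} C(a, ρ_j) C(a, b_l) = K q^{-ρ_j² - b_l²} C(ρ_j, b_l)` (`sum_alcove_cosKer`), which is
`K^n q^{-(ρ, ρ) - (b, b)} Q_μ`; and `K^n q^{-(ρ, ρ)}` is the sum over `X_{N/2}` in the denominator of `d_λ`.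

*Duality.* The maximal element of `W` is `-1`, so `λ^* = λ`.
-/

/-! ### Powers of `q` -/

theorem qpow_zero (t : ℂ) : qpow t 0 = 1 := by simp [qpow]

theorem qpow_add (t : ℂ) (x y : ℝ) : qpow t (x + y) = qpow t x * qpow t y := by
  simp only [qpow, ← Complex.exp_add]
  push_cast
  ring_nf

theorem qpow_ne_zero (t : ℂ) (x : ℝ) : qpow t x ≠ 0 := Complex.exp_ne_zero _

theorem qpow_neg (t : ℂ) (x : ℝ) : qpow t (-x) = (qpow t x)⁻¹ := by
  simp [qpow, ← Complex.exp_neg]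

theorem qpow_sub (t : ℂ) (x y : ℝ) : qpow t (x - y) = qpow t x * (qpow t y)⁻¹ := by
  rw [sub_eq_add_neg, qpow_add, qpow_neg]

theorem qpow_sum {ι : Type*} (t : ℂ) (s : Finset ι) (f : ι → ℝ) :
    qpow t (∑ i ∈ s, f i) = ∏ i ∈ s, qpow t (f i) := by
  simp [qpow, ← Complex.exp_sum, Finset.mul_sum]

theorem qpow_natCast_mul (t : ℂ) (m : ℕ) (x : ℝ) : qpow t (m * x) = qpow t x ^ m := by
  simp only [qpow, ← Complex.exp_nat_mul]
  push_cast
  ring_nf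

theorem continuous_qpow (x : ℝ) : Continuous fun t => qpow t x := by
  unfold qpow
  fun_prop

theorem qpow_root_eq_one_iff {N : ℕ} (hN : N ≠ 0) (D : ℤ) :
    qpow (rootParam N) D = 1 ↔ (N : ℤ) ∣ D := by
  have hN' : (N : ℂ) ≠ 0 := by exact_mod_cast hN
  have hpi := Complex.two_pi_I_ne_zero
  rw [qpow, rootParam, Complex.exp_eq_one_iff]
  constructor
  · rintro ⟨m, hm⟩
    refine ⟨m, ?_⟩
    have : (D : ℂ) = N * m := by
      have h : (2 * Real.pi * Complex.I) * (D : ℂ) = (2 * Real.pi * Complex.I) * (N * m) := by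
        field_simp at hm
        push_cast at hm
        linear_combination (2 * Real.pi * Complex.I) * hm
      exact mul_left_cancel₀ hpi h
    exact_mod_cast this
  · rintro ⟨m, rfl⟩
    refine ⟨m, ?_⟩
    push_cast
    field_simp

/-- Exponents of `q = exp(2πi / N)` matter only modulo `N`. -/
theorem qpow_root_congr {N : ℕ} (hN : N ≠ 0) {x y : ℝ} (z : ℤ) (h : x = y + N * z) :
    qpow (rootParam N) x = qpow (rootParam N) y := by
  have h1 : qpow (rootParam N) ((N : ℝ) * z) = 1 := by
    have := (qpow_root_eq_one_iff hN (N * z)).2 (dvd_mul_right _ _)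
    push_cast at this
    exact this
  rw [h, qpow_add, h1, mul_one]

theorem qpow_root_half {N : ℕ} (hN : N ≠ 0) : qpow (rootParam N) ((N : ℝ) / 2) = -1 := by
  have hN' : (N : ℂ) ≠ 0 := by exact_mod_cast hN
  rw [qpow, rootParam, ← Complex.exp_pi_mul_I]
  congr 1
  push_cast
  field_simp

/-- Adding an odd multiple of `N / 2` to the exponent changes the sign. -/
theorem qpow_root_antiperiodic {N : ℕ} (hN : N ≠ 0) {x y : ℝ} (z : ℤ)
    (h : x = y + N / 2 + N * z) : qpow (rootParam N) x = -qpow (rootParam N) y := by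
  rw [qpow_root_congr hN z h, qpow_add, qpow_root_half hN, mul_neg_one]

/-! ### Determinants -/

/-- Expansion of a determinant whose rows are sums. -/
theorem det_of_sum {ι α R : Type*} [Fintype ι] [DecidableEq ι] [Fintype α] [DecidableEq α]
    [CommRing R] (F : ι → α → ι → R) :
    (Matrix.of fun i j => ∑ a, F i a j).det =
      ∑ f : ι → α, (Matrix.of fun i j => F i (f i) j).det := by
  have h := (Matrix.detRowAlternating (n := ι) (R := R)).toMultilinearMap.map_sum
    (fun i (a : α) => F i a)
  have e : (fun i => ∑ a, F i a) = (Matrix.of fun i j => ∑ a, F i a j) := by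
    funext i j; simp
  rw [e] at h
  exact h

/-- The Cauchy–Binet formula, the maximal minors being indexed by strictly increasing maps. -/
theorem det_mul_eq_sum_strictMono {n : ℕ} {α R : Type*} [Fintype α] [LinearOrder α] [CommRing R]
    (A : Matrix (Fin n) α R) (B : Matrix α (Fin n) R) :
    (A * B).det = ∑ f : {f : Fin n → α // StrictMono f},
      (A.submatrix id f.1).det * (B.submatrix f.1 id).det := by
  classical
  set P : (Fin n → α) → R := fun f => (∏ i, A i (f i)) * (B.submatrix f id).det with hP
  have h1 : (A * B).det = ∑ f : Fin n → α, P f := by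
    have : A * B = Matrix.of fun i j => ∑ a, A i a * B a j := by
      ext i j; simp [Matrix.mul_apply]
    rw [this, det_of_sum]
    refine Finset.sum_congr rfl fun f _ => ?_
    exact Matrix.det_mul_column (fun i => A i (f i)) (B.submatrix f id)
  have h2 : ∀ f : {f : Fin n → α // StrictMono f},
      (A.submatrix id f.1).det * (B.submatrix f.1 id).det =
        ∑ σ : Equiv.Perm (Fin n), P (f.1 ∘ σ) := by
    intro f
    rw [← Matrix.det_transpose, Matrix.det_apply', Finset.sum_mul]
    refine Finset.sum_congr rfl fun σ _ => ?_
    have : B.submatrix (f.1 ∘ σ) id = (B.submatrix f.1 id).submatrix σ id := rfl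
    simp only [hP]
    rw [this, Matrix.det_permute]
    simp only [Matrix.transpose_apply, Matrix.submatrix_apply, id, Function.comp]
    ring
  simp only [h2]
  rw [h1, ← Fintype.sum_prod_type']
  symm
  -- maps that are not injective give repeated rows; the others are sorted uniquely
  refine Finset.sum_of_injOn (fun p => p.1.1 ∘ p.2) ?_ (by simp) ?_ (by simp)
  · rintro ⟨⟨f, hf⟩, σ⟩ - ⟨⟨g, hg⟩, τ⟩ - h
    simp only at h
    have hr : Set.range f = Set.range g := by
      rw [← σ.surjective.range_comp f, ← τ.surjective.range_comp g, h]
    obtain rfl : f = g := (hf.range_inj hg).1 hr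
    have : σ = τ := by
      ext i
      exact congrArg _ (hf.injective (congrFun h i))
    rw [this]
  · intro f _ hf
    have : ¬ Function.Injective f := by
      intro hinj
      apply hf
      refine ⟨(⟨f ∘ Tuple.sort f, (Tuple.monotone_sort f).strictMono_of_injective
        (hinj.comp (Equiv.injective _))⟩, (Tuple.sort f)⁻¹), by simp, ?_⟩
      funext i
      simp
    obtain ⟨i, j, hij, hne⟩ : ∃ i j, f i = f j ∧ i ≠ j := by
      simpa [Function.Injective] using this
    simp only [hP]
    rw [Matrix.det_zero_of_row_eq hne, mul_zero]
    funext l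
    simp [hij]

/-- The polynomials `P_m` with `(z + z⁻¹) P_m(z² + z⁻²) = z^(2m+1) + z^(-(2m+1))`. -/
noncomputable def oddCosPoly : ℕ → Polynomial ℂ
  | 0 => 1
  | 1 => Polynomial.X - 1
  | m + 2 => Polynomial.X * oddCosPoly (m + 1) - oddCosPoly m

theorem oddCosPoly_monic_natDegree (m : ℕ) :
    (oddCosPoly m).Monic ∧ (oddCosPoly m).natDegree = m := by
  induction m using Nat.strong_induction_on with
  | _ m ih =>
    match m with
    | 0 => simp [oddCosPoly]
    | 1 =>
      have h : oddCosPoly 1 = Polynomial.X - Polynomial.C 1 := by simp [oddCosPoly]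
      rw [h]
      exact ⟨Polynomial.monic_X_sub_C 1, Polynomial.natDegree_X_sub_C 1⟩
    | m + 2 =>
      obtain ⟨h1, h2⟩ := ih (m + 1) (by omega)
      obtain ⟨h3, h4⟩ := ih m (by omega)
      have hX : (Polynomial.X * oddCosPoly (m + 1)).Monic := Polynomial.monic_X.mul h1
      have hd : (Polynomial.X * oddCosPoly (m + 1)).natDegree = m + 2 := by
        rw [Polynomial.natDegree_X_mul h1.ne_zero, h2]
      have hlt : (oddCosPoly m).natDegree < (Polynomial.X * oddCosPoly (m + 1)).natDegree := by
        omega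
      rw [oddCosPoly]
      exact ⟨hX.sub_of_left (Polynomial.degree_lt_degree hlt),
        by rw [Polynomial.natDegree_sub_eq_left_of_natDegree_lt hlt, hd]⟩

theorem oddCosPoly_eval (m : ℕ) {z : ℂ} (hz : z ≠ 0) :
    (z + z⁻¹) * (oddCosPoly m).eval (z ^ 2 + z⁻¹ ^ 2) = z ^ (2 * m + 1) + z⁻¹ ^ (2 * m + 1) := by
  have hzz : z * z⁻¹ = 1 := mul_inv_cancel₀ hz
  induction m using Nat.strong_induction_on with
  | _ m ih =>
    match m with
    | 0 => simp [oddCosPoly]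
    | 1 =>
      simp only [oddCosPoly, Polynomial.eval_sub, Polynomial.eval_X, Polynomial.eval_one]
      linear_combination (z + z⁻¹) * hzz
    | m + 2 =>
      have h1 := ih (m + 1) (by omega)
      have h2 := ih m (by omega)
      simp only [oddCosPoly, Polynomial.eval_sub, Polynomial.eval_mul, Polynomial.eval_X]
      have e : z ^ 2 * z⁻¹ ^ 2 = 1 := by rw [← mul_pow, hzz, one_pow]
      have e1 : z ^ (2 * (m + 1) + 1) * z⁻¹ ^ 2 = z ^ (2 * m + 1) := by
        linear_combination z ^ (2 * m + 1) * e
      have e2 : z⁻¹ ^ (2 * (m + 1) + 1) * z ^ 2 = z⁻¹ ^ (2 * m + 1) := by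
        linear_combination z⁻¹ ^ (2 * m + 1) * e
      linear_combination (z ^ 2 + z⁻¹ ^ 2) * h1 - h2 + e1 + e2

/-- A cosine determinant is a Vandermonde determinant in `z² + z⁻²`. -/
theorem det_oddCos_ne_zero {n : ℕ} (z : Fin n → ℂ) (hz : ∀ j, z j ≠ 0)
    (h1 : ∀ j, z j + (z j)⁻¹ ≠ 0)
    (h2 : Function.Injective fun j => z j ^ 2 + (z j)⁻¹ ^ 2) :
    (Matrix.of fun i j : Fin n =>
      z j ^ (2 * (i : ℕ) + 1) + (z j)⁻¹ ^ (2 * (i : ℕ) + 1)).det ≠ 0 := by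
  have e : (Matrix.of fun i j : Fin n =>
      z j ^ (2 * (i : ℕ) + 1) + (z j)⁻¹ ^ (2 * (i : ℕ) + 1)) =
      Matrix.of fun i j => (z j + (z j)⁻¹) *
        (Matrix.of fun j i : Fin n =>
          (oddCosPoly i).eval (z j ^ 2 + (z j)⁻¹ ^ 2)).transpose i j := by
    ext i j
    exact (oddCosPoly_eval i (hz j)).symm
  rw [e, Matrix.det_mul_row, Matrix.det_transpose,
    ← Matrix.det_eval_matrixOfPolynomials_eq_det_vandermonde _ (fun i : Fin n => oddCosPoly i)
      (fun i => (oddCosPoly_monic_natDegree i).2) (fun i => (oddCosPoly_monic_natDegree i).1)]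
  exact mul_ne_zero (Finset.prod_ne_zero_iff.2 fun j _ => h1 j)
    (Matrix.det_vandermonde_ne_zero_iff.2 h2)

/-! ### The sums over the Weyl group as determinants -/

/-- The kernel `q^{2ab} + q^{-2ab}`: twice the cosine attached to `a` and `b`. -/
noncomputable def cosKer (t : ℂ) (a b : ℝ) : ℂ := qpow t (2 * a * b) + qpow t (-(2 * a * b))

/-- The sign changes in `W` turn exponentials into cosines, and the remaining alternating sum over
permutations is a determinant. -/
theorem sum_weyl_eq_det {n : ℕ} (t : ℂ) (x y : HDual n) :
    ∑ w : Weyl n, (w.epsPrime : ℂ) * qpow t (2 * (x ⬝ᵥ w.act y)) =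
      (Matrix.of fun i j => cosKer t (x i) (y j)).det := by
  rw [Matrix.det_apply', Fintype.sum_prod_type_right]
  refine Finset.sum_congr rfl fun π _ => ?_
  simp only [Weyl.epsPrime]
  rw [← Finset.mul_sum]
  congr 1
  have h : ∀ s : Fin n → ℤˣ, qpow t (2 * (x ⬝ᵥ Weyl.act (s, π) y)) =
      ∏ i, qpow t (2 * x i * ((((s i : ℤˣ) : ℤ) : ℝ) * y (π⁻¹ i))) := by
    intro s
    rw [← qpow_sum, dotProduct, Finset.mul_sum]
    simp only [Weyl.act, mul_assoc]
  simp only [h]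
  rw [← Fintype.piFinset_univ, ← Finset.prod_univ_sum (fun _ => Finset.univ)
    (fun i (u : ℤˣ) => qpow t (2 * x i * (((u : ℤ) : ℝ) * y (π⁻¹ i)))), ← Equiv.prod_comp π]
  refine Finset.prod_congr rfl fun i _ => ?_
  rw [show (Finset.univ : Finset ℤˣ) = {1, -1} from rfl, Finset.sum_pair (by decide)]
  simp [cosKer]

theorem SPrime_eq_det {n : ℕ} (t : ℂ) (lam mu : Weight n) :
    SPrime t lam mu =
      (Matrix.of fun i j => cosKer t (lam i + rho n i) (mu j + rho n j)).det :=
  sum_weyl_eq_det t _ _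

theorem QDen_eq_det {n : ℕ} (t : ℂ) (mu : Weight n) :
    QDen t mu = (Matrix.of fun i j => cosKer t (rho n i) (mu j + rho n j)).det :=
  sum_weyl_eq_det t _ _

theorem qpow_sq (t : ℂ) (b : ℝ) : qpow t b ^ 2 = qpow t (2 * b) := by
  rw [← qpow_natCast_mul]; norm_num

theorem QDen_ne_zero {n : ℕ} (t : ℂ) (mu : Weight n)
    (h1 : ∀ j, qpow t (4 * (mu j + rho n j)) ≠ 1)
    (h2 : ∀ i j, i < j → qpow t (2 * ((mu i + rho n i) - (mu j + rho n j))) ≠ 1)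
    (h3 : ∀ i j, i < j → qpow t (2 * ((mu i + rho n i) + (mu j + rho n j))) ≠ 1) :
    QDen t mu ≠ 0 := by
  set b : Fin n → ℝ := fun j => mu j + rho n j with hb
  set z : Fin n → ℂ := fun j => qpow t (b j) with hz
  have hz0 : ∀ j, z j ≠ 0 := fun j => qpow_ne_zero _ _
  have key : ∀ i j, i < j → z i ^ 2 + (z i)⁻¹ ^ 2 ≠ z j ^ 2 + (z j)⁻¹ ^ 2 := by
    intro i j hij h
    have hi : z i ^ 2 ≠ 0 := pow_ne_zero _ (hz0 i)
    have hj : z j ^ 2 ≠ 0 := pow_ne_zero _ (hz0 j)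
    have hf : (z i ^ 2 - z j ^ 2) * (z i ^ 2 * z j ^ 2 - 1) = 0 := by
      simp only [inv_pow] at h
      field_simp at h
      rw [div_eq_div_iff hi hj] at h
      linear_combination h
    rcases mul_eq_zero.1 hf with h | h
    · apply h2 i j hij
      rw [mul_sub, qpow_sub, ← qpow_sq, ← qpow_sq]
      exact (mul_inv_eq_one₀ hj).2 (sub_eq_zero.1 h)
    · apply h3 i j hij
      rw [mul_add, qpow_add, ← qpow_sq, ← qpow_sq]
      exact sub_eq_zero.1 h
  have hdet := det_oddCos_ne_zero z hz0 (fun j h => h1 j ?_) (fun i j h => ?_)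
  · rw [QDen_eq_det]
    intro h0
    apply hdet
    -- the rows, which belong to `ρ = (n - 1/2, …, 1/2)`, are taken in reverse order
    have e : (Matrix.of fun i j : Fin n =>
        z j ^ (2 * (i : ℕ) + 1) + (z j)⁻¹ ^ (2 * (i : ℕ) + 1)) =
        (Matrix.of fun i j => cosKer t (rho n i) (mu j + rho n j)).submatrix Fin.revPerm id := by
      ext i j
      have hr : rho n i.rev = (i : ℕ) + 1 / 2 := by
        rw [rho_apply, Fin.val_rev, Nat.cast_sub (by omega)]
        push_cast; ring
      simp only [Matrix.of_apply, Matrix.submatrix_apply, Fin.revPerm_apply, id, hr, cosKer, hz]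
      rw [← qpow_neg, ← qpow_natCast_mul, ← qpow_natCast_mul]
      push_cast
      congr 2 <;> ring
    rw [e, Matrix.det_permute, h0, mul_zero]
  · have hs : z j ^ 2 = -1 := by
      have := hz0 j
      field_simp at h
      linear_combination h
    have : qpow t (4 * b j) = (z j ^ 2) ^ 2 := by
      rw [← pow_mul, ← qpow_natCast_mul]; norm_num
    rw [this, hs]; norm_num
  · by_contra hne
    rcases lt_or_gt_of_ne hne with hlt | hlt
    · exact key i j hlt h
    · exact key j i hlt h.symm

/-! ### Sums over residues -/

/-- The sum of a periodic function over a period does not depend on the starting point. -/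
theorem sum_range_periodic_shift {p : ℕ} (f : ℤ → ℂ) (hf : ∀ l, f (l + p) = f l) (c : ℤ) :
    ∑ i ∈ Finset.range p, f (i + c) = ∑ i ∈ Finset.range p, f i := by
  have step : ∀ c : ℤ, ∑ i ∈ Finset.range p, f (i + (c + 1)) = ∑ i ∈ Finset.range p, f (i + c) := by
    intro c
    have h1 := Finset.sum_range_succ (fun i : ℕ => f (i + c)) p
    have h2 := Finset.sum_range_succ' (fun i : ℕ => f (i + c)) p
    have h3 : f ((p : ℤ) + c) = f ((0 : ℕ) + c) := by
      rw [add_comm, hf]; simp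
    rw [h1, h3] at h2
    have h4 := add_right_cancel h2
    rw [h4]
    refine Finset.sum_congr rfl fun i _ => ?_
    congr 1; push_cast; ring
  induction c with
  | zero => simp
  | succ c ih => rw [step, ih]
  | pred c ih => rw [← ih, ← step]; simp

theorem sum_range_zmod {M : ℕ} [NeZero M] (f : ZMod M → ℂ) :
    ∑ i ∈ Finset.range M, f i = ∑ x, f x := by
  refine Finset.sum_bij' (fun i _ => (i : ZMod M)) (fun x _ => x.val) (by simp)
    (fun x _ => by simpa using ZMod.val_lt x) ?_ (by simp) (by simp)
  intro i hi
  exact ZMod.val_cast_of_lt (by simpa using hi)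

/-! ### Quadratic Gauss sums to an odd modulus -/

/-- Modulo an odd number, `-1` is a sum of two squares: by Dirichlet's theorem it is congruent to a
prime `p ≡ 1 (mod 4)`. -/
theorem neg_one_eq_sq_add_sq {M : ℕ} (hM : Odd M) : ∃ a b : ZMod M, a ^ 2 + b ^ 2 = -1 := by
  have hco : Nat.Coprime 4 M := by
    have := Nat.Coprime.pow_left 2 (Nat.coprime_two_left.2 hM)
    simpa using this
  have hM0 : M ≠ 0 := by rintro rfl; simp at hM
  obtain ⟨r, hr4, hrM⟩ := Nat.chineseRemainder hco 1 (M - 1)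
  have hM1 : 1 ≤ M := Nat.one_le_iff_ne_zero.2 hM0
  have hr : r.Coprime (4 * M) := by
    refine Nat.Coprime.mul_right ?_ ?_
    · exact (Nat.ModEq.gcd_eq hr4).trans (by norm_num)
    · refine (Nat.ModEq.gcd_eq hrM).trans ?_
      have := (Nat.coprime_self_sub_right hM1).2 (Nat.coprime_one_right M)
      exact this.symm
  obtain ⟨p, -, hp, hpr⟩ := Nat.forall_exists_prime_gt_and_modEq 0 (by omega : 4 * M ≠ 0) hr
  have := Fact.mk hp
  have hp4 : p ≡ 1 [MOD 4] := (hpr.of_mul_right M).trans hr4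
  have hpM : p ≡ M - 1 [MOD M] := (hpr.of_mul_left 4).trans hrM
  obtain ⟨a, b, hab⟩ := Nat.Prime.sq_add_sq (p := p) (by rw [hp4]; norm_num)
  refine ⟨a, b, ?_⟩
  have h := (ZMod.natCast_eq_natCast_iff _ _ _).2 hpM
  rw [← hab, Nat.cast_sub hM1] at h
  push_cast at h
  simpa using h

/-- The quadratic Gauss sum to an odd modulus `M`, with `h = 1 / 2`, has fourth power `M ^ 2`. As
`-1 = a² + b²`, the substitution `(x, y) ↦ (ax + by, ay - bx)` turns `x² + y²` into its negative,
so that the square of the sum equals the square of its complex conjugate; their product is `M`. -/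
theorem quadratic_gaussSum_pow_four {M : ℕ} [NeZero M] (hM : Odd M) {h : ZMod M} (hh : 2 * h = 1) :
    (∑ x : ZMod M, ZMod.stdAddChar (h * x ^ 2)) ^ 4 = (M : ℂ) ^ 2 := by
  set ψ := ZMod.stdAddChar (N := M) with hψ
  have hprim : ψ.IsPrimitive := ZMod.isPrimitive_stdAddChar M
  obtain ⟨a, b, hab⟩ := neg_one_eq_sq_add_sq hM
  have hsq : (∑ x, ψ (h * x ^ 2)) ^ 2 = (∑ x, ψ (-(h * x ^ 2))) ^ 2 := by
    simp only [sq (∑ x, _), Finset.sum_mul_sum, ← AddChar.map_add_eq_mul, ← Fintype.sum_prod_type']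
    refine (Fintype.sum_equiv
      { toFun := fun p => (a * p.1 + b * p.2, a * p.2 - b * p.1)
        invFun := fun p => (b * p.2 - a * p.1, -(b * p.1 + a * p.2))
        left_inv := fun p => ?_
        right_inv := fun p => ?_ } _ _ fun p => ?_).symm
    · ext
      · simp only; linear_combination -p.1 * hab
      · simp only; linear_combination -p.2 * hab
    · ext
      · simp only; linear_combination -p.1 * hab
      · simp only; linear_combination -p.2 * hab
    · congr 1
      simp only [Equiv.coe_fn_mk]
      linear_combination -h * (p.1 ^ 2 + p.2 ^ 2) * hab
  have hmul : (∑ x, ψ (h * x ^ 2)) * (∑ x, ψ (-(h * x ^ 2))) = M := by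
    simp only [Finset.sum_mul_sum, ← AddChar.map_add_eq_mul]
    rw [Finset.sum_comm]
    have e : ∀ y : ZMod M, ∑ x, ψ (h * x ^ 2 + -(h * y ^ 2)) = ∑ u, ψ (h * u ^ 2) * ψ (y * u) := by
      intro y
      rw [← Equiv.sum_comp (Equiv.addRight y)]
      refine Finset.sum_congr rfl fun u _ => ?_
      rw [← AddChar.map_add_eq_mul, Equiv.coe_addRight]
      congr 1
      linear_combination y * u * hh
    simp only [e]
    rw [Finset.sum_comm]
    simp only [← Finset.mul_sum, AddChar.sum_mulShift _ hprim]
    simp [ZMod.card]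
  calc (∑ x, ψ (h * x ^ 2)) ^ 4 = (∑ x, ψ (h * x ^ 2)) ^ 2 * (∑ x, ψ (h * x ^ 2)) ^ 2 := by ring
    _ = ((∑ x, ψ (h * x ^ 2)) * (∑ x, ψ (-(h * x ^ 2)))) ^ 2 := by
      nth_rewrite 2 [hsq]; ring
    _ = _ := by rw [hmul]

/-! ### The sums `G(N, m)` -/

theorem qCas_summand_periodic {N : ℕ} (hN : N ≠ 0) (m l : ℤ) :
    qpow (rootParam N) (((l + N : ℤ) : ℝ) * ((l + N : ℤ) + m)) =
      qpow (rootParam N) ((l : ℝ) * (l + m)) := by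
  refine qpow_root_congr hN (2 * l + N + m) ?_
  push_cast; ring

/-- Completing the square: `G(N, 2b) = q^{1/4 - b²} G(N, 1)` for every half odd integer `b`. -/
theorem sum_qpow_half_odd {N : ℕ} (hN : N ≠ 0) (c : ℤ) :
    ∑ l ∈ Finset.range N, qpow (rootParam N) ((l : ℝ) * (l + 2 * (c + 1 / 2))) =
      qpow (rootParam N) (1 / 4 - (c + 1 / 2) ^ 2) * gaussG N 1 := by
  have h := sum_range_periodic_shift (p := N)
    (fun l : ℤ => qpow (rootParam N) ((l : ℝ) * (l + (1 : ℤ))))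
    (qCas_summand_periodic hN 1) c
  simp only [gaussG]
  push_cast at h ⊢
  rw [← h, Finset.mul_sum]
  refine Finset.sum_congr rfl fun l _ => ?_
  rw [← qpow_add]
  congr 1; ring

theorem gaussG_odd {N : ℕ} (hN : N ≠ 0) (c : ℕ) :
    gaussG N (2 * c + 1) = qpow (rootParam N) (1 / 4 - (c + 1 / 2) ^ 2) * gaussG N 1 := by
  have := sum_qpow_half_odd hN c
  push_cast at this
  rw [← this, gaussG]
  refine Finset.sum_congr rfl fun l _ => ?_
  congr 1; push_cast; ring

/-- For `N ≡ 0 (mod 4)` the summand changes sign under a shift by `N / 2`. -/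
theorem qpow_shift_half_of_four_dvd {k : ℕ} (hk : 1 ≤ k) (l c : ℤ) :
    qpow (rootParam (4 * k)) ((l + 2 * k : ℝ) * (l + 2 * k + (2 * c + 1))) =
      -qpow (rootParam (4 * k)) ((l : ℝ) * (l + (2 * c + 1))) := by
  refine qpow_root_antiperiodic (by omega) (l + k + c) ?_
  push_cast; ring

theorem gaussG_one_eq_zero {k : ℕ} (hk : 1 ≤ k) : gaussG (4 * k) 1 = 0 := by
  rw [gaussG, show 4 * k = 2 * k + 2 * k by ring, Finset.sum_range_add, ← Finset.sum_add_distrib]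
  refine Finset.sum_eq_zero fun l _ => ?_
  have h := qpow_shift_half_of_four_dvd hk l 0
  rw [show 2 * k + 2 * k = 4 * k by ring]
  push_cast at h ⊢
  rw [add_comm (2 * (k : ℝ)) (l : ℝ)]
  norm_num at h ⊢
  rw [h]; ring

/-- For `N ≡ 0 (mod 4)` the first half of the sum `G(N, 1)` vanishes as well: its terms at `l` and
`N / 2 - 1 - l` cancel. -/
theorem half_gauss_sum_eq_zero {k : ℕ} (hk : 1 ≤ k) :
    ∑ l ∈ Finset.range (2 * k), qpow (rootParam (4 * k)) ((l : ℝ) * (l + 1)) = 0 := by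
  have h : ∑ l ∈ Finset.range (2 * k), qpow (rootParam (4 * k)) ((l : ℝ) * (l + 1)) =
      -∑ l ∈ Finset.range (2 * k), qpow (rootParam (4 * k)) ((l : ℝ) * (l + 1)) := by
    conv_lhs => rw [← Finset.sum_range_reflect]
    rw [← Finset.sum_neg_distrib]
    refine Finset.sum_congr rfl fun l hl => ?_
    have hl := Finset.mem_range.1 hl
    have h := qpow_shift_half_of_four_dvd hk (-1 - l) 0
    rw [Nat.cast_sub (by omega), Nat.cast_sub (by omega)]
    push_cast at h ⊢
    have e1 : ((2 * k - 1 - l : ℝ)) * (2 * k - 1 - l + 1) =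
      (-1 - l + 2 * k) * (-1 - l + 2 * k + (2 * 0 + 1)) := by ring
    have e2 : (l : ℝ) * (l + 1) = (-1 - l) * (-1 - l + (2 * 0 + 1)) := by ring
    rw [e1, e2, h]
  exact self_eq_neg.1 h

/-- For `N = 2M`, `M` odd, the summand depends only on the class modulo `M`. -/
theorem qpow_shift_half_of_odd {N k : ℕ} (hN : N = 2 * (2 * k + 1)) (l c z : ℤ) :
    qpow (rootParam N) ((l + (2 * k + 1) * z : ℝ) * (l + (2 * k + 1) * z + (2 * c + 1))) =
      qpow (rootParam N) ((l : ℝ) * (l + (2 * c + 1))) := by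
  obtain ⟨w, hw⟩ : ∃ w : ℤ, z * (z + 1) = 2 * w := by
    obtain ⟨w, hw⟩ := Int.even_mul_succ_self z
    exact ⟨w, by rw [hw]; ring⟩
  have hw' : (z : ℝ) * (z + 1) = 2 * w := by exact_mod_cast hw
  refine qpow_root_congr (by omega) (l * z + c * z + w + k * z ^ 2) ?_
  subst hN
  push_cast
  linear_combination (2 * (k : ℝ) + 1) * hw'

theorem gaussG_odd_eq_two_mul {N k : ℕ} (hN : N = 2 * (2 * k + 1)) (c : ℕ) :
    gaussG N (2 * c + 1) = 2 * ∑ l ∈ Finset.range (2 * k + 1),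
      qpow (rootParam N) ((l : ℝ) * (l + (2 * c + 1))) := by
  have hr : Finset.range N = Finset.range ((2 * k + 1) + (2 * k + 1)) := by
    rw [hN, two_mul (2 * k + 1)]
  rw [gaussG, hr, Finset.sum_range_add, two_mul (∑ l ∈ _, _)]
  congr 1
  · push_cast; rfl
  · refine Finset.sum_congr rfl fun l _ => ?_
    have h := qpow_shift_half_of_odd hN l c 1
    push_cast at h ⊢
    rw [← h]
    congr 1; ring

/-- The fourth power of `G(N, 1)`. It determines `G(N, 1)` up to a fourth root of unity, which is
all that is needed to write it as `(1 + i)√N / x` with `x` a primitive `4N`-th root of unity. -/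
theorem gaussG_one_pow_four {N k : ℕ} (hN : N = 2 * (2 * k + 1)) :
    gaussG N 1 ^ 4 * qpow (rootParam N) 1 = -4 * (N : ℂ) ^ 2 := by
  have hN0 : N ≠ 0 := by omega
  set M := 2 * k + 1 with hM
  have hMC : ((2 * k + 1 : ℕ) : ℂ) ≠ 0 := by exact_mod_cast (by omega : 2 * k + 1 ≠ 0)
  have hModd : Odd M := ⟨k, rfl⟩
  have : NeZero M := ⟨by omega⟩
  set h : ZMod M := ((k + 1 : ℕ) : ZMod M) with hh
  have h2 : 2 * h = 1 := by
    have : ((M : ℕ) : ZMod M) = 0 := ZMod.natCast_self M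
    rw [hM] at this
    rw [hh]
    push_cast at this ⊢
    linear_combination this
  -- the standard character at `h j` is `q^{(M + 1) j}`
  have hchar : ∀ j : ℤ, ZMod.stdAddChar (h * (j : ZMod M)) =
      qpow (rootParam N) (2 * (k + 1) * j) := by
    intro j
    have : h * (j : ZMod M) = (((k + 1 : ℕ) * j : ℤ) : ZMod M) := by
      rw [hh]; push_cast; ring
    rw [this, ZMod.stdAddChar_coe, qpow, rootParam, hN, hM]
    congr 1
    push_cast at hMC ⊢
    field_simp
  have h1 := gaussG_odd_eq_two_mul hN 0
  have hsum : ∑ l ∈ Finset.range M, qpow (rootParam N) ((l : ℝ) * (l + (2 * (0 : ℕ) + 1))) =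
      ZMod.stdAddChar (-h ^ 3) * ∑ x : ZMod M, ZMod.stdAddChar (h * x ^ 2) := by
    have e1 : ∀ l : ℕ, qpow (rootParam N) ((l : ℝ) * (l + (2 * (0 : ℕ) + 1))) =
        ZMod.stdAddChar (h * ((l : ZMod M) * ((l : ZMod M) + 1))) := by
      intro l
      have := hchar ((l : ℤ) * (l + 1))
      push_cast at this
      rw [this]
      obtain ⟨w, hw⟩ := Nat.even_mul_succ_self l
      have hw' : (l : ℝ) * (l + 1) = w + w := by exact_mod_cast hw
      symm
      refine qpow_root_congr hN0 w ?_
      rw [hN, hM]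
      push_cast
      linear_combination (2 * (k : ℝ) + 1) * hw'
    simp only [e1]
    rw [sum_range_zmod (fun x : ZMod M => ZMod.stdAddChar (h * (x * (x + 1)))), Finset.mul_sum,
      ← Equiv.sum_comp (Equiv.addRight h) fun x : ZMod M => _ * _]
    refine Finset.sum_congr rfl fun x _ => ?_
    rw [← AddChar.map_add_eq_mul, Equiv.coe_addRight]
    congr 1
    linear_combination -h * x * h2
  have hc : ZMod.stdAddChar (-h ^ 3) ^ 4 * qpow (rootParam N) 1 = -1 := by
    have e : ZMod.stdAddChar (-h ^ 3) ^ 4 = qpow (rootParam N) (2 * (k + 1) * (-1 : ℤ)) := by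
      rw [← hchar, ← AddChar.map_nsmul_eq_pow]
      congr 1
      rw [nsmul_eq_mul]
      push_cast
      linear_combination (-2 * h ^ 2 - h) * h2
    rw [e, ← qpow_add]
    have := qpow_root_antiperiodic hN0 (x := 2 * (k + 1) * ((-1 : ℤ) : ℝ) + 1) (y := 0) (-1) (by
      rw [hN, hM]; push_cast; ring)
    rw [this, qpow_zero]
  rw [show (1 : ℕ) = 2 * 0 + 1 from rfl, h1, hsum, mul_pow, mul_pow,
    quadratic_gaussSum_pow_four hModd h2]
  have hNM : (N : ℂ) = 2 * M := by exact_mod_cast hN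
  linear_combination 16 * (M : ℂ) ^ 2 * hc + 4 * ((N : ℂ) + 2 * M) * hNM

theorem gaussG_one_ne_zero {N k : ℕ} (hN : N = 2 * (2 * k + 1)) : gaussG N 1 ≠ 0 := by
  intro h
  have := gaussG_one_pow_four hN
  rw [h] at this
  have hN' : (N : ℂ) ≠ 0 := by exact_mod_cast (by omega : N ≠ 0)
  have : (N : ℂ) ^ 2 = 0 := by linear_combination (1 / 4 : ℂ) * this
  exact pow_ne_zero 2 hN' this

/-- For even `N`, every fourth root of `exp(2πi / N)` is a primitive `4N`-th root of unity. -/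
theorem isPrimitiveRoot_of_pow_four {N : ℕ} (hN : N ≠ 0) (he : Even N) {x : ℂ}
    (hx : x ^ 4 = qpow (rootParam N) 1) : IsPrimitiveRoot x (4 * N) := by
  have hq : IsPrimitiveRoot (x ^ 4) N := by
    rw [hx]
    have := Complex.isPrimitiveRoot_exp N hN
    convert this using 1
    rw [qpow, rootParam]
    congr 1
    push_cast; ring
  refine (IsPrimitiveRoot.iff (by omega)).2 ⟨by rw [pow_mul, hq.pow_eq_one], ?_⟩
  intro l hl0 hl hl1
  have h1 : (x ^ 4) ^ l = 1 := by rw [← pow_mul, mul_comm, pow_mul, hl1, one_pow]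
  obtain ⟨w, rfl⟩ := hq.dvd_of_pow_eq_one l h1
  have hw4 : w < 4 := by
    by_contra hw
    have : N * 4 ≤ N * w := Nat.mul_le_mul_left N (by omega)
    omega
  have hw0 : 0 < w := Nat.pos_of_mul_pos_left hl0
  -- `x ^ (2N) = q ^ (N/2) = -1` excludes the remaining proper divisors of `4N`
  obtain ⟨r, hr⟩ := he
  have hr0 : 0 < r := by omega
  have hm : x ^ (2 * N) = -1 := by
    have e : x ^ (2 * N) = (x ^ 4) ^ r := by rw [← pow_mul]; congr 1; omega
    have e2 : x ^ (2 * N) * x ^ (2 * N) = 1 := by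
      rw [← sq, ← pow_mul, show 2 * N * 2 = 4 * N by ring, pow_mul, hq.pow_eq_one]
    rcases mul_self_eq_one_iff.1 e2 with h | h
    · exfalso
      have := Nat.le_of_dvd hr0 (hq.dvd_of_pow_eq_one r (e ▸ h))
      omega
    · exact h
  have h2 : (-1 : ℂ) ^ w = 1 := by
    rw [← hm, ← pow_mul, show 2 * N * w = N * w * 2 by ring, pow_mul, hl1, one_pow]
  obtain rfl : w = 2 := by
    interval_cases w
    · norm_num at h2
    · rfl
    · norm_num at h2
  rw [mul_comm N 2, hm] at hl1
  norm_num at hl1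

theorem gaussG_eq_primitiveRoot {N k : ℕ} (hN : N = 2 * (2 * k + 1)) :
    ∃ x : ℂ, IsPrimitiveRoot x (4 * N) ∧ ∀ m : ℕ, Odd m →
      gaussG N m = (1 + Complex.I) * (Real.sqrt N : ℂ) / x ^ (m ^ 2) := by
  have hN0 : N ≠ 0 := by omega
  have hG := gaussG_one_ne_zero hN
  have hG4 := gaussG_one_pow_four hN
  have hNC : (N : ℂ) ≠ 0 := by exact_mod_cast hN0
  have hs2 : (Real.sqrt N : ℂ) ^ 2 = N := by
    rw [← Complex.ofReal_pow, Real.sq_sqrt (Nat.cast_nonneg N)]; simp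
  have hs : (Real.sqrt N : ℂ) ≠ 0 := by
    intro h; rw [h] at hs2; exact hNC (by simpa using hs2.symm)
  have hI2 : (1 + Complex.I) ^ 2 = 2 * Complex.I := by
    linear_combination Complex.I_sq
  have hI : (1 + Complex.I) ≠ 0 := by
    intro h; rw [h] at hI2; simp at hI2
  set x : ℂ := (1 + Complex.I) * (Real.sqrt N : ℂ) / gaussG N 1 with hx
  have hx0 : x ≠ 0 := div_ne_zero (mul_ne_zero hI hs) hG
  have hx4 : x ^ 4 = qpow (rootParam N) 1 := by
    rw [hx, div_pow, div_eq_iff (pow_ne_zero 4 hG), mul_comm _ (gaussG N 1 ^ 4), hG4]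
    have : ((1 + Complex.I) * (Real.sqrt N : ℂ)) ^ 4 =
        ((1 + Complex.I) ^ 2) ^ 2 * ((Real.sqrt N : ℂ) ^ 2) ^ 2 := by ring
    rw [this, hI2, hs2]
    linear_combination 4 * (N : ℂ) ^ 2 * Complex.I_sq
  refine ⟨x, isPrimitiveRoot_of_pow_four hN0 ⟨2 * k + 1, by omega⟩ hx4, ?_⟩
  rintro m ⟨c, rfl⟩
  have e : x ^ ((2 * c + 1) ^ 2) = qpow (rootParam N) (c * (c + 1)) * x := by
    rw [show (2 * c + 1) ^ 2 = 4 * (c * (c + 1)) + 1 by ring, pow_succ, pow_mul, hx4,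
      ← qpow_natCast_mul]
    push_cast
    rw [mul_one]
  have hGx : (1 + Complex.I) * (Real.sqrt N : ℂ) = gaussG N 1 * x := by
    rw [hx]; field_simp
  rw [gaussG_odd hN0, e, hGx, show (1 / 4 - ((c : ℝ) + 1 / 2) ^ 2) = -(c * (c + 1)) by ring,
    qpow_neg]
  have := qpow_ne_zero (rootParam N) (c * (c + 1))
  field_simp

/-! ### Products over the coordinates -/

theorem rho_eq_half_odd {n : ℕ} (i : Fin n) : rho n i = ((n - 1 - i : ℕ) : ℝ) + 1 / 2 := by
  have hi := i.2
  rw [rho_apply, Nat.cast_sub (show (i : ℕ) ≤ n - 1 by omega),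
    Nat.cast_sub (show 1 ≤ n by omega)]
  push_cast; ring

theorem weight_add_rho {n : ℕ} (mu : Weight n) (i : Fin n) :
    (mu i : ℝ) + rho n i = ((mu i + (n - 1 - i) : ℕ) : ℝ) + 1 / 2 := by
  rw [rho_eq_half_odd]; push_cast; ring

theorem qCas_eq_prod (N : ℕ) {n : ℕ} (mu : Weight n) :
    qCas N mu = ∏ i, qpow (rootParam N) ((mu i : ℝ) * (mu i + 2 * rho n i)) := by
  rw [qCas, ← qpow_sum]
  rfl

theorem chiV_eq_inv (N : ℕ) {n : ℕ} (mu : Weight n) : chiV N mu = (qCas N mu)⁻¹ := qpow_neg _ _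

/-- `(μ, μ + 2ρ) = (μ + ρ, μ + ρ) - (ρ, ρ)`. -/
theorem qCas_eq_prod_sq (N : ℕ) {n : ℕ} (mu : Weight n) :
    qCas N mu = (∏ i, qpow (rootParam N) ((mu i + rho n i) ^ 2)) *
      (∏ i, qpow (rootParam N) (rho n i ^ 2))⁻¹ := by
  rw [qCas_eq_prod, ← Finset.prod_inv_distrib, ← Finset.prod_mul_distrib]
  refine Finset.prod_congr rfl fun i _ => ?_
  rw [← qpow_neg, ← qpow_add]
  congr 1; ring

theorem sum_pi_fin_prod {M n : ℕ} (f : Fin n → ℕ → ℂ) :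
    ∑ a : Fin n → Fin M, ∏ i, f i (a i) = ∏ i, ∑ l ∈ Finset.range M, f i l := by
  simp only [← Fin.sum_univ_eq_sum_range]
  rw [Finset.prod_univ_sum, Fintype.piFinset_univ]

theorem casSum_eq_prod (N M n : ℕ) :
    casSum N M n = ∏ i : Fin n, ∑ l ∈ Finset.range M,
      qpow (rootParam N) ((l : ℝ) * (l + 2 * rho n i)) := by
  simp only [casSum, qCas_eq_prod, XMod.rep]
  exact sum_pi_fin_prod fun i l => qpow (rootParam N) ((l : ℝ) * (l + 2 * rho n i))

theorem two_mul_rho {n : ℕ} (i : Fin n) : 2 * rho n i = 2 * ((n - 1 - i : ℕ) : ℝ) + 1 := by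
  rw [rho_eq_half_odd]; ring

theorem casSum_self (N n : ℕ) : casSum N N n = ∏ i : Fin n, gaussG N (2 * (n - 1 - i) + 1) := by
  rw [casSum_eq_prod]
  refine Finset.prod_congr rfl fun i _ => Finset.sum_congr rfl fun l _ => ?_
  rw [two_mul_rho]; push_cast; rfl

theorem casSum_self_eq_prod_range (N n : ℕ) :
    casSum N N n = ∏ j ∈ Finset.range n, gaussG N (2 * j + 1) := by
  rw [casSum_self, ← Finset.prod_range_reflect, ← Fin.prod_univ_eq_prod_range]

theorem casSum_self_eq_gaussG_one {N : ℕ} (hN : N ≠ 0) (n : ℕ) :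
    casSum N N n = (∏ _i : Fin n, (qpow (rootParam N) (1 / 4) * gaussG N 1)) *
      (∏ i, qpow (rootParam N) (rho n i ^ 2))⁻¹ := by
  rw [casSum_self, ← Finset.prod_inv_distrib, ← Finset.prod_mul_distrib]
  refine Finset.prod_congr rfl fun i _ => ?_
  rw [gaussG_odd hN, qpow_sub, rho_eq_half_odd]
  ring

theorem casSum_half_of_odd {N k : ℕ} (hN : N = 2 * (2 * k + 1)) (n : ℕ) :
    casSum N (N / 2) n = casSum N N n / 2 ^ n := by
  have h2 : N / 2 = 2 * k + 1 := by omega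
  rw [eq_div_iff (pow_ne_zero n two_ne_zero), casSum_self, casSum_eq_prod, h2]
  have : (2 : ℂ) ^ n = ∏ _i : Fin n, 2 := by simp
  rw [this, ← Finset.prod_mul_distrib]
  refine Finset.prod_congr rfl fun i _ => ?_
  rw [gaussG_odd_eq_two_mul hN, two_mul_rho, mul_comm]

theorem casSum_self_ne_zero {N k : ℕ} (hN : N = 2 * (2 * k + 1)) (n : ℕ) : casSum N N n ≠ 0 := by
  rw [casSum_self_eq_gaussG_one (by omega)]
  refine mul_ne_zero (Finset.prod_ne_zero_iff.2 fun i _ => ?_)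
    (inv_ne_zero (Finset.prod_ne_zero_iff.2 fun i _ => qpow_ne_zero _ _))
  exact mul_ne_zero (qpow_ne_zero _ _) (gaussG_one_ne_zero hN)

theorem casSum_half_ne_zero {N k : ℕ} (hN : N = 2 * (2 * k + 1)) (n : ℕ) :
    casSum N (N / 2) n ≠ 0 := by
  rw [casSum_half_of_odd hN]
  exact div_ne_zero (casSum_self_ne_zero hN n) (pow_ne_zero n two_ne_zero)

theorem qCas_congr_half {N k n : ℕ} (hN : N = 2 * (2 * k + 1)) {lam lam' : Weight n}
    (h : ∀ i, lam i ≡ lam' i [MOD N / 2]) : qCas N lam = qCas N lam' := by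
  rw [qCas_eq_prod, qCas_eq_prod]
  refine Finset.prod_congr rfl fun i _ => ?_
  obtain ⟨z, hz⟩ := (Nat.modEq_iff_dvd.1 (h i))
  have h2 : N / 2 = 2 * k + 1 := by omega
  rw [h2] at hz
  have hz' : (lam' i : ℝ) = ((lam i : ℤ) : ℝ) + (2 * k + 1) * z := by
    have : (lam' i : ℤ) = lam i + (2 * k + 1) * z := by
      push_cast at hz; linarith
    exact_mod_cast this
  have := qpow_shift_half_of_odd hN (lam i) ((n - 1 - i : ℕ) : ℤ) z
  rw [two_mul_rho, hz']
  push_cast at this ⊢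
  exact this.symm

theorem qCas_add_single_of_four_dvd {k n : ℕ} (hk : 1 ≤ k) (lam : Weight n) (i : Fin n) :
    qCas (4 * k) (lam + Pi.single i (4 * k / 2)) = -qCas (4 * k) lam := by
  rw [qCas_eq_prod, qCas_eq_prod, ← Finset.mul_prod_erase _ _ (Finset.mem_univ i),
    ← Finset.mul_prod_erase _ _ (Finset.mem_univ i), ← neg_mul]
  congr 1
  · have := qpow_shift_half_of_four_dvd hk (lam i) ((n - 1 - i : ℕ) : ℤ)
    have h2 : 4 * k / 2 = 2 * k := by omega
    rw [two_mul_rho, h2]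
    simp only [Pi.add_apply, Pi.single_eq_same]
    push_cast at this ⊢
    exact this
  · refine Finset.prod_congr rfl fun j hj => ?_
    simp [Finset.ne_of_mem_erase hj]

theorem casSum_eq_zero_of_four_dvd {k n : ℕ} (hk : 1 ≤ k) (hn : 1 ≤ n) :
    casSum (4 * k) (4 * k) n = 0 := by
  rw [casSum_self_eq_gaussG_one (by omega), gaussG_one_eq_zero hk]
  simp [Nat.one_le_iff_ne_zero.1 hn]

theorem casSum_half_eq_zero_of_four_dvd {k n : ℕ} (hk : 1 ≤ k) (hn : 1 ≤ n) :
    casSum (4 * k) (4 * k / 2) n = 0 := by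
  rw [casSum_eq_prod]
  -- the factor of the last coordinate, where `2ρ_i = 1`
  refine Finset.prod_eq_zero (Finset.mem_univ (⟨n - 1, by omega⟩ : Fin n)) ?_
  rw [two_mul_rho, show 4 * k / 2 = 2 * k by omega]
  simpa using half_gauss_sum_eq_zero hk

/-! ### The unfolded equations -/

/-- The Gauss sum over a full period reproduces the cosine kernel. -/
theorem sum_sq_mul_cosKer {N : ℕ} (hN : N ≠ 0) (r : ℝ) (c : ℤ) :
    ∑ l ∈ Finset.range N, qpow (rootParam N) ((l : ℝ) ^ 2) *
        cosKer (rootParam N) (l + r) (c + 1 / 2) =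
      (qpow (rootParam N) (1 / 4) * gaussG N 1 * (qpow (rootParam N) ((c + 1 / 2) ^ 2))⁻¹) *
        cosKer (rootParam N) r (c + 1 / 2) := by
  have h1 := sum_qpow_half_odd hN c
  have h2 := sum_qpow_half_odd hN (-c - 1)
  have e : ((1 : ℝ) / 4 - ((-c - 1 : ℤ) + 1 / 2) ^ 2) = 1 / 4 - (c + 1 / 2) ^ 2 := by
    push_cast; ring
  rw [e] at h2
  have hs : ∀ l : ℕ, qpow (rootParam N) ((l : ℝ) ^ 2) *
        cosKer (rootParam N) (l + r) (c + 1 / 2) =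
      qpow (rootParam N) (2 * r * (c + 1 / 2)) *
        qpow (rootParam N) ((l : ℝ) * (l + 2 * (c + 1 / 2))) +
      qpow (rootParam N) (-(2 * r * (c + 1 / 2))) *
        qpow (rootParam N) ((l : ℝ) * (l + 2 * ((-c - 1 : ℤ) + 1 / 2))) := by
    intro l
    rw [cosKer, mul_add, ← qpow_add, ← qpow_add, ← qpow_add, ← qpow_add]
    push_cast
    congr 2 <;> ring
  simp only [hs]
  rw [Finset.sum_add_distrib, ← Finset.mul_sum, ← Finset.mul_sum, h1, h2, cosKer, qpow_sub]
  ring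

/-- The right-hand side of the unfolded equation: the rows of `S'` depend on one coordinate of `λ`
each, so that the sum over `X_N` is a determinant of Gauss sums. -/
theorem sum_unfolded {N : ℕ} (hN : N ≠ 0) {n : ℕ} (c : ℂ) (mu : Weight n) :
    ∑ a : Fin n → Fin N,
      (c * qpow (rootParam N) (-((XMod.rep a).toH ⬝ᵥ ((2 : ℝ) • rho n)))) *
        qCas N (XMod.rep a) * SPrime (rootParam N) (XMod.rep a) mu =
    c * (((∏ _i : Fin n, (qpow (rootParam N) (1 / 4) * gaussG N 1)) *
      (∏ i, qpow (rootParam N) ((mu i + rho n i) ^ 2))⁻¹) * QDen (rootParam N) mu) := by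
  have h1 : ∀ a : Fin n → Fin N,
      (c * qpow (rootParam N) (-((XMod.rep a).toH ⬝ᵥ ((2 : ℝ) • rho n)))) *
        qCas N (XMod.rep a) * SPrime (rootParam N) (XMod.rep a) mu =
      c * (Matrix.of fun i j => qpow (rootParam N) (((a i : ℕ) : ℝ) ^ 2) *
        cosKer (rootParam N) ((a i : ℕ) + rho n i) (mu j + rho n j)).det := by
    intro a
    rw [SPrime_eq_det, qCas, mul_assoc c, ← qpow_add, mul_assoc]
    congr 1
    have e : -((XMod.rep a).toH ⬝ᵥ ((2 : ℝ) • rho n)) +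
        (XMod.rep a).toH ⬝ᵥ ((XMod.rep a).toH + (2 : ℝ) • rho n) =
        ∑ i, ((a i : ℕ) : ℝ) ^ 2 := by
      rw [dotProduct_add, neg_add_cancel_comm_assoc]
      exact Finset.sum_congr rfl fun i _ => (sq _).symm
    rw [e, qpow_sum]
    exact (Matrix.det_mul_column _ (Matrix.of fun i j =>
      cosKer (rootParam N) ((a i : ℕ) + rho n i) (mu j + rho n j))).symm
  simp only [h1]
  rw [← Finset.mul_sum, ← det_of_sum (fun (i : Fin n) (l : Fin N) (j : Fin n) =>
    qpow (rootParam N) (((l : ℕ) : ℝ) ^ 2) *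
      cosKer (rootParam N) ((l : ℕ) + rho n i) (mu j + rho n j))]
  congr 1
  rw [QDen_eq_det, ← Finset.prod_inv_distrib, ← Finset.prod_mul_distrib, ← Matrix.det_mul_row]
  congr 1
  ext i j
  simp only [Matrix.of_apply]
  rw [Fin.sum_univ_eq_sum_range (fun l : ℕ => qpow (rootParam N) ((l : ℝ) ^ 2) *
    cosKer (rootParam N) (l + rho n i) (mu j + rho n j)) N, weight_add_rho]
  exact_mod_cast sum_sq_mul_cosKer hN (rho n i) ((mu j + (n - 1 - j) : ℕ) : ℤ)

theorem unfoldedSolves_of_odd {N k : ℕ} (hN : N = 2 * (2 * k + 1)) {n : ℕ} (mu : Weight n) :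
    UnfoldedSolves N (casSum N N n)⁻¹ mu := by
  have hN0 : N ≠ 0 := by omega
  have h0 := casSum_self_ne_zero hN n
  have hc := casSum_self_eq_gaussG_one hN0 n
  rw [UnfoldedSolves, sum_unfolded hN0, chiV_eq_inv, qCas_eq_prod_sq, hc]
  rw [hc] at h0
  have hr : (∏ i, qpow (rootParam N) (rho n i ^ 2)) ≠ 0 :=
    Finset.prod_ne_zero_iff.2 fun i _ => qpow_ne_zero _ _
  have hm : (∏ i, qpow (rootParam N) ((mu i + rho n i) ^ 2)) ≠ 0 :=
    Finset.prod_ne_zero_iff.2 fun i _ => qpow_ne_zero _ _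
  have hg := left_ne_zero_of_mul h0
  field_simp

theorem not_unfoldedSolves_of_four_dvd {k n : ℕ} (hk : 1 ≤ k) (hn : 1 ≤ n) {mu : Weight n}
    (hQ : QDen (rootParam (4 * k)) mu ≠ 0) (c : ℂ) : ¬ UnfoldedSolves (4 * k) c mu := by
  rw [UnfoldedSolves, sum_unfolded (by omega), gaussG_one_eq_zero hk]
  simp only [mul_zero, Finset.prod_const, Finset.card_univ, Fintype.card_fin,
    zero_pow (Nat.one_le_iff_ne_zero.1 hn), zero_mul]
  exact mul_ne_zero hQ (qpow_ne_zero _ _)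

/-! ### The sums over the alcove -/

/-- The Gauss sum over the half odd integers modulo `M = 2k + 1`. -/
noncomputable def halfGauss (N k : ℕ) : ℂ :=
  ∑ e ∈ Finset.range (2 * k + 1), qpow (rootParam N) (((e : ℝ) + 1 / 2) ^ 2)

theorem sum_half_shift {N k : ℕ} (hN : N = 2 * (2 * k + 1)) (c : ℤ) :
    ∑ e ∈ Finset.range (2 * k + 1), qpow (rootParam N) (((e : ℝ) + c + 1 / 2) ^ 2) =
      halfGauss N k := by
  have h := sum_range_periodic_shift (p := 2 * k + 1)
    (fun e : ℤ => qpow (rootParam N) (((e : ℝ) + 1 / 2) ^ 2)) (fun l => by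
      refine qpow_root_congr (by omega) (l + k + 1) ?_
      rw [hN]; push_cast; ring) c
  push_cast at h
  exact h

theorem casSum_half_eq_halfGauss {N k : ℕ} (hN : N = 2 * (2 * k + 1)) (n : ℕ) :
    casSum N (N / 2) n = (∏ _i : Fin n, halfGauss N k) *
      (∏ i, qpow (rootParam N) (rho n i ^ 2))⁻¹ := by
  rw [casSum_eq_prod, show N / 2 = 2 * k + 1 by omega, ← Finset.prod_inv_distrib,
    ← Finset.prod_mul_distrib]
  refine Finset.prod_congr rfl fun i _ => ?_
  rw [← sum_half_shift hN ((n - 1 - i : ℕ) : ℤ), Finset.sum_mul]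
  refine Finset.sum_congr rfl fun l _ => ?_
  rw [← qpow_neg, ← qpow_add, rho_eq_half_odd]
  congr 1; push_cast; ring

theorem cosKer_neg_left (t : ℂ) (a b : ℝ) : cosKer t (-a) b = cosKer t a b := by
  rw [cosKer, cosKer, add_comm]
  congr 2 <;> ring

theorem cosKer_wall {N k : ℕ} (hN : N = 2 * (2 * k + 1)) (c : ℤ) :
    cosKer (rootParam N) (k + 1 / 2) (c + 1 / 2) = 0 := by
  have h : qpow (rootParam N) (2 * (k + 1 / 2) * (c + 1 / 2)) =
      -qpow (rootParam N) (-(2 * (k + 1 / 2) * (c + 1 / 2))) := by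
    refine qpow_root_antiperiodic (by omega) c ?_
    rw [hN]; push_cast; ring
  rw [cosKer, h]; ring

/-- The one-dimensional orthogonality relation. The summand is even and periodic modulo
`M = 2k + 1` and vanishes on the wall `M / 2`, so that the sum over the alcove `0 < a < M / 2` is
half of a full Gauss sum. -/
theorem sum_alcove_cosKer {N k : ℕ} (hN : N = 2 * (2 * k + 1)) (r b : ℤ) :
    ∑ e ∈ Finset.range k, qpow (rootParam N) (((e : ℝ) + 1 / 2) ^ 2) *
        cosKer (rootParam N) (e + 1 / 2) (r + 1 / 2) *
        cosKer (rootParam N) (e + 1 / 2) (b + 1 / 2) =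
      halfGauss N k * (qpow (rootParam N) ((r + 1 / 2) ^ 2))⁻¹ *
        (qpow (rootParam N) ((b + 1 / 2) ^ 2))⁻¹ *
        cosKer (rootParam N) (r + 1 / 2) (b + 1 / 2) := by
  have hN0 : N ≠ 0 := by omega
  set t := rootParam N with ht
  set f : ℤ → ℂ := fun e => qpow t (((e : ℝ) + 1 / 2) ^ 2) *
    cosKer t (e + 1 / 2) (r + 1 / 2) * cosKer t (e + 1 / 2) (b + 1 / 2) with hf
  -- the summand as a combination of shifted squares
  have hexp : ∀ e : ℤ, f e =
      qpow t (-(((r : ℝ) + 1 / 2) + (b + 1 / 2)) ^ 2) *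
        (qpow t ((e + (r + b + 1 : ℤ) + 1 / 2) ^ 2) +
          qpow t ((e + (-r - b - 1 : ℤ) + 1 / 2) ^ 2)) +
      qpow t (-(((r : ℝ) + 1 / 2) - (b + 1 / 2)) ^ 2) *
        (qpow t ((e + (r - b : ℤ) + 1 / 2) ^ 2) +
          qpow t ((e + (b - r : ℤ) + 1 / 2) ^ 2)) := by
    intro e
    simp only [hf, cosKer, mul_add, add_mul, ← qpow_add]
    push_cast
    ring_nf
  have hsym : ∀ e : ℤ, f (-1 - e) = f e := by
    intro e
    have e1 : ((-1 - e : ℤ) : ℝ) + 1 / 2 = -(e + 1 / 2) := by push_cast; ring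
    simp only [hf, e1, cosKer_neg_left, neg_sq]
  have hper : ∀ e : ℤ, f (e + (2 * k + 1 : ℕ)) = f e := by
    intro e
    have h : ∀ c : ℤ, qpow t (((e + (2 * k + 1 : ℕ) : ℤ) + c + 1 / 2 : ℝ) ^ 2) =
        qpow t ((e + c + 1 / 2) ^ 2) := by
      intro c
      refine qpow_root_congr hN0 (e + c + k + 1) ?_
      rw [hN]; push_cast; ring
    rw [hexp, hexp, h, h, h, h]
  have hwall : f k = 0 := by
    simp only [hf, Int.cast_natCast]
    rw [ht, cosKer_wall hN]; simp
  have hfull : ∑ e ∈ Finset.range (2 * k + 1), f e =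
      2 * halfGauss N k * (qpow t ((r + 1 / 2) ^ 2))⁻¹ * (qpow t ((b + 1 / 2) ^ 2))⁻¹ *
        cosKer t (r + 1 / 2) (b + 1 / 2) := by
    simp only [hexp, Int.cast_natCast]
    rw [Finset.sum_add_distrib, ← Finset.mul_sum, ← Finset.mul_sum, Finset.sum_add_distrib,
      Finset.sum_add_distrib, sum_half_shift hN, sum_half_shift hN, sum_half_shift hN,
      sum_half_shift hN]
    have e1 : -(((r : ℝ) + 1 / 2) + (b + 1 / 2)) ^ 2 =
      -(r + 1 / 2) ^ 2 + (-(b + 1 / 2) ^ 2 + -(2 * (r + 1 / 2) * (b + 1 / 2))) := by ring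
    have e2 : -(((r : ℝ) + 1 / 2) - (b + 1 / 2)) ^ 2 =
      -(r + 1 / 2) ^ 2 + (-(b + 1 / 2) ^ 2 + 2 * (r + 1 / 2) * (b + 1 / 2)) := by ring
    rw [e1, e2, qpow_add, qpow_add, qpow_add, qpow_add, ← qpow_neg, ← qpow_neg, cosKer]
    ring
  have hfold : ∑ e ∈ Finset.range (2 * k + 1), f e = 2 * ∑ e ∈ Finset.range k, f e := by
    rw [show 2 * k + 1 = (k + 1) + k by ring, Finset.sum_range_add, Finset.sum_range_succ, hwall,
      add_zero, two_mul]
    congr 1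
    rw [← Finset.sum_range_reflect]
    refine Finset.sum_congr rfl fun e he => ?_
    have he := Finset.mem_range.1 he
    rw [← hsym, ← hper]
    congr 1
    push_cast [Nat.cast_sub (show e ≤ k - 1 by omega), Nat.cast_sub (show 1 ≤ k by omega)]
    ring
  have : ∑ e ∈ Finset.range k, f e = halfGauss N k * (qpow t ((r + 1 / 2) ^ 2))⁻¹ *
      (qpow t ((b + 1 / 2) ^ 2))⁻¹ * cosKer t (r + 1 / 2) (b + 1 / 2) := by
    rw [hfold] at hfull
    linear_combination hfull / 2
  rw [← this]
  simp only [hf, Int.cast_natCast]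

/-! ### The alcove -/

theorem dotProduct_eps {n : ℕ} (x : HDual n) (i : Fin n) : x ⬝ᵥ eps i = x i := by simp [eps]

theorem pairing_eps {n : ℕ} (x : HDual n) (i : Fin n) :
    2 * (x ⬝ᵥ eps i) / (eps i ⬝ᵥ eps i) = 2 * x i := by
  simp [dotProduct_eps]
  simp [eps]

theorem pairing_eps_sub {n : ℕ} (x : HDual n) {i j : Fin n} (h : i < j) :
    2 * (x ⬝ᵥ (eps i - eps j)) / ((eps i - eps j) ⬝ᵥ (eps i - eps j)) = x i - x j := by
  simp only [dotProduct_sub, dotProduct_eps, Pi.sub_apply]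
  simp [eps, h.ne, h.ne']
  ring

theorem pairing_eps_add {n : ℕ} (x : HDual n) {i j : Fin n} (h : i < j) :
    2 * (x ⬝ᵥ (eps i + eps j)) / ((eps i + eps j) ⬝ᵥ (eps i + eps j)) = x i + x j := by
  simp only [dotProduct_add, dotProduct_eps, Pi.add_apply]
  simp [eps, h.ne, h.ne']
  ring

/-- The integers `e_i` with `(λ + ρ)_i = e_i + 1/2`. -/
def shifted {n : ℕ} (lam : Weight n) : Weight n := fun i => lam i + (n - 1 - i)

theorem add_rho_eq_shifted {n : ℕ} (lam : Weight n) (i : Fin n) :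
    (lam i : ℝ) + rho n i = (shifted lam i : ℝ) + 1 / 2 := weight_add_rho lam i

/-- The conditions at the roots `ε_i ± ε_j`. -/
theorem forall_phiZero_iff {n : ℕ} {N : ℕ} (lam : Weight n) :
    (∀ α ∈ phiZero n, 0 < 2 * ((lam.toH + rho n) ⬝ᵥ α) / (α ⬝ᵥ α) ∧
      2 * ((lam.toH + rho n) ⬝ᵥ α) / (α ⬝ᵥ α) < (N : ℝ) / 2) ↔
    ∀ i j : Fin n, i < j → shifted lam j < shifted lam i ∧
      2 * (shifted lam i + shifted lam j + 1) < N := by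
  have hx : ∀ i, (lam.toH + rho n) i = (shifted lam i : ℝ) + 1 / 2 := add_rho_eq_shifted lam
  constructor
  · intro h i j hij
    have h1 := h _ (mem_phiZero.2 (Or.inl ⟨i, j, hij, rfl⟩))
    have h2 := h _ (mem_phiZero.2 (Or.inr ⟨i, j, hij, rfl⟩))
    rw [pairing_eps_sub _ hij, hx, hx] at h1
    rw [pairing_eps_add _ hij, hx, hx] at h2
    constructor
    · have : (shifted lam j : ℝ) < shifted lam i := by linarith [h1.1]
      exact_mod_cast this
    · have : 2 * ((shifted lam i : ℝ) + shifted lam j + 1) < N := by linarith [h2.2]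
      exact_mod_cast this
  · intro h α hα
    have key : ∀ i j : Fin n, i < j → (shifted lam j : ℝ) < shifted lam i ∧
        2 * ((shifted lam i : ℝ) + shifted lam j + 1) < N ∧ (0 : ℝ) ≤ shifted lam j := by
      intro i j hij
      have := h i j hij
      exact ⟨by exact_mod_cast this.1, by exact_mod_cast this.2, Nat.cast_nonneg _⟩
    rcases mem_phiZero.1 hα with ⟨i, j, hij, rfl⟩ | ⟨i, j, hij, rfl⟩
    · rw [pairing_eps_sub _ hij, hx, hx]
      obtain ⟨a, b, c⟩ := key i j hij
      constructor <;> linarith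
    · rw [pairing_eps_add _ hij, hx, hx]
      obtain ⟨a, b, c⟩ := key i j hij
      constructor <;> linarith

theorem NPrime_of_even {N : ℕ} (h : Even N) : NPrime N = (N : ℝ) / 2 := by
  rw [NPrime, if_neg (Nat.not_odd_iff_even.2 h)]

theorem shifted_of_mem_LambdaPlus {N n : ℕ} (hN : Even N) {lam : Weight n}
    (h : lam ∈ LambdaPlus N n) : ∀ i j : Fin n, i < j → shifted lam j < shifted lam i ∧
      2 * (shifted lam i + shifted lam j + 1) < N := by
  unfold LambdaPlus at h
  split_ifs at h with h1
  · subst h1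
    intro i j hij
    exact absurd hij (by simp [Subsingleton.elim i j])
  · rw [← forall_phiZero_iff]
    intro α hα
    rw [← NPrime_of_even hN]
    refine h α ?_
    unfold phi
    split_ifs <;> simp [hα]

/-- For `N = 2(2k+1)` the alcove is `k + 1/2 > (λ+ρ)_1 > … > (λ+ρ)_n > 0`. -/
theorem mem_LambdaPlus_iff {N k n : ℕ} (hN : N = 2 * (2 * k + 1)) (lam : Weight n) :
    lam ∈ LambdaPlus N n ↔ StrictAnti (shifted lam) ∧ ∀ i, shifted lam i < k := by
  have he : Even N := ⟨2 * k + 1, by omega⟩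
  have h4 : N % 4 = 2 := by omega
  have hx : ∀ i, (lam.toH + rho n) i = (shifted lam i : ℝ) + 1 / 2 := add_rho_eq_shifted lam
  have hNR : (N : ℝ) = 2 * (2 * k + 1) := by rw [hN]; push_cast; ring
  have hk : ∀ i, shifted lam i < k ↔ (shifted lam i : ℝ) + 1 / 2 < (N : ℝ) / 4 := by
    intro i
    rw [hNR]
    constructor
    · intro h
      have : (shifted lam i : ℝ) < k := by exact_mod_cast h
      linarith
    · intro h
      have : (shifted lam i : ℝ) < k := by linarith
      exact_mod_cast this
  have hpos : ∀ i, (0 : ℝ) < (shifted lam i : ℝ) + 1 / 2 := fun i => by positivity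
  constructor
  · intro h
    refine ⟨fun i j hij => (shifted_of_mem_LambdaPlus he h i j hij).1, fun i => ?_⟩
    rw [hk]
    unfold LambdaPlus at h
    split_ifs at h with h1
    · have := (h (eps i) (mem_oddRoots.2 ⟨i, rfl⟩)).2
      rwa [dotProduct_eps, hx, NDoublePrime, if_pos h4] at this
    · have hm : eps i ∈ phi N n := by
        rw [phi, if_pos h4]
        exact Finset.mem_union_right _ (mem_oddRoots.2 ⟨i, rfl⟩)
      have := (h (eps i) hm).2
      rw [pairing_eps, hx, NPrime_of_even he] at this
      linarith
  · rintro ⟨h1, h2⟩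
    unfold LambdaPlus
    split_ifs with hn
    · intro α hα
      obtain ⟨i, rfl⟩ := mem_oddRoots.1 hα
      rw [dotProduct_eps, hx, NDoublePrime, if_pos h4]
      exact ⟨hpos i, (hk i).1 (h2 i)⟩
    · intro α hα
      rw [phi, if_pos h4] at hα
      rw [NPrime_of_even he]
      rcases Finset.mem_union.1 hα with hα | hα
      · refine (forall_phiZero_iff lam).2 (fun i j hij => ⟨h1 hij, ?_⟩) α hα
        have := h2 i
        have := h2 j
        omega
      · obtain ⟨i, rfl⟩ := mem_oddRoots.1 hα
        rw [pairing_eps, hx]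
        have := (hk i).1 (h2 i)
        have := hpos i
        constructor <;> linarith

theorem le_of_strictAnti {n : ℕ} {e : Fin n → ℕ} (he : StrictAnti e) (i : Fin n) :
    n - 1 - i ≤ e i := by
  obtain ⟨m, hm⟩ : ∃ m, m = n - 1 - (i : ℕ) := ⟨_, rfl⟩
  rw [← hm]
  induction m generalizing i with
  | zero => exact Nat.zero_le _
  | succ m ih =>
    have h1 := ih ⟨i + 1, by omega⟩ (by simp only; omega)
    have h2 : e ⟨i + 1, by omega⟩ < e i := he (by simp [Fin.lt_def])
    omega

theorem zero_mem_LambdaPlus {N k n : ℕ} (hN : N = 2 * (2 * k + 1))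
    (h : (LambdaPlus N n).Nonempty) : (0 : Weight n) ∈ LambdaPlus N n := by
  obtain ⟨lam, hlam⟩ := h
  obtain ⟨h1, h2⟩ := (mem_LambdaPlus_iff hN lam).1 hlam
  refine (mem_LambdaPlus_iff hN 0).2 ⟨fun i j hij => ?_, fun i => ?_⟩
  · have : (i : ℕ) < j := hij
    simp only [shifted, Pi.zero_apply]
    omega
  · have := le_of_strictAnti h1 i
    have := h2 i
    simp only [shifted, Pi.zero_apply]
    omega

/-- The weight with `λ + ρ = f + 1/2`, for a strictly decreasing `f` with values below `k`. The
order dual turns decreasing maps into the increasing ones of `det_mul_eq_sum_strictMono`. The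
subtraction of natural numbers does not truncate, by `le_of_strictAnti`. -/
def weightOfStrictMono {n k : ℕ} (f : {f : Fin n → (Fin k)ᵒᵈ // StrictMono f}) : Weight n :=
  fun i => ((OrderDual.ofDual (f.1 i) : Fin k) : ℕ) - (n - 1 - i)

theorem shifted_weightOfStrictMono {n k : ℕ} (f : {f : Fin n → (Fin k)ᵒᵈ // StrictMono f}) :
    shifted (weightOfStrictMono f) = fun i => ((OrderDual.ofDual (f.1 i) : Fin k) : ℕ) := by
  funext i
  exact Nat.sub_add_cancel
    (le_of_strictAnti (e := fun i => ((OrderDual.ofDual (f.1 i) : Fin k) : ℕ)) (fun i j hij => f.2 hij) i)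

theorem weightOfStrictMono_injective {n k : ℕ} :
    Function.Injective (weightOfStrictMono (n := n) (k := k)) := by
  intro f g h
  have := congrArg shifted h
  rw [shifted_weightOfStrictMono, shifted_weightOfStrictMono] at this
  ext i
  exact congrFun this i

theorem range_weightOfStrictMono {N k n : ℕ} (hN : N = 2 * (2 * k + 1)) :
    Set.range (weightOfStrictMono (n := n) (k := k)) = LambdaPlus N n := by
  ext lam
  rw [mem_LambdaPlus_iff hN]
  constructor
  · rintro ⟨f, rfl⟩
    rw [shifted_weightOfStrictMono]
    exact ⟨fun i j hij => f.2 hij, fun i => (OrderDual.ofDual (f.1 i)).2⟩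
  · rintro ⟨h1, h2⟩
    refine ⟨⟨fun i => OrderDual.toDual ⟨shifted lam i, h2 i⟩, fun i j hij => h1 hij⟩, ?_⟩
    funext i
    simp [weightOfStrictMono, shifted]

/-! ### Nonvanishing of the denominators and the generic limits -/

theorem QDen_root_ne_zero {N n : ℕ} (hN : N ≠ 0) (mu : Weight n)
    (h : ∀ i j : Fin n, i < j → shifted mu j < shifted mu i ∧
      2 * (shifted mu i + shifted mu j + 1) < N)
    (h1 : ∀ j, ¬ N ∣ 4 * shifted mu j + 2) : QDen (rootParam N) mu ≠ 0 := by
  refine QDen_ne_zero _ mu (fun j hj => ?_) (fun i j hij hq => ?_) (fun i j hij hq => ?_)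
  · rw [add_rho_eq_shifted, show (4 : ℝ) * (shifted mu j + 1 / 2) =
      ((4 * shifted mu j + 2 : ℕ) : ℤ) by push_cast; ring, qpow_root_eq_one_iff hN] at hj
    exact h1 j (Int.natCast_dvd_natCast.1 hj)
  · obtain ⟨ha, hb⟩ := h i j hij
    rw [add_rho_eq_shifted, add_rho_eq_shifted, show (2 : ℝ) * (shifted mu i + 1 / 2 -
      (shifted mu j + 1 / 2)) = ((2 * (shifted mu i - shifted mu j) : ℕ) : ℤ) by
        push_cast [Nat.cast_sub ha.le]; ring, qpow_root_eq_one_iff hN] at hq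
    have := Nat.le_of_dvd (by omega) (Int.natCast_dvd_natCast.1 hq)
    omega
  · obtain ⟨ha, hb⟩ := h i j hij
    rw [add_rho_eq_shifted, add_rho_eq_shifted, show (2 : ℝ) * (shifted mu i + 1 / 2 +
      (shifted mu j + 1 / 2)) = ((2 * (shifted mu i + shifted mu j + 1) : ℕ) : ℤ) by
        push_cast; ring, qpow_root_eq_one_iff hN] at hq
    have := Nat.le_of_dvd (by omega) (Int.natCast_dvd_natCast.1 hq)
    omega

theorem QDen_ne_zero_of_odd {N k n : ℕ} (hN : N = 2 * (2 * k + 1)) {mu : Weight n}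
    (hmu : mu ∈ LambdaPlus N n) : QDen (rootParam N) mu ≠ 0 := by
  refine QDen_root_ne_zero (by omega) mu
    (shifted_of_mem_LambdaPlus ⟨2 * k + 1, by omega⟩ hmu) fun j hj => ?_
  have := ((mem_LambdaPlus_iff hN mu).1 hmu).2 j
  have := Nat.le_of_dvd (by omega) hj
  omega

theorem QDen_ne_zero_of_four_dvd {k n : ℕ} (hk : 1 ≤ k) {mu : Weight n}
    (hmu : mu ∈ LambdaPlus (4 * k) n) : QDen (rootParam (4 * k)) mu ≠ 0 := by
  refine QDen_root_ne_zero (by omega) mu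
    (shifted_of_mem_LambdaPlus ⟨2 * k, by omega⟩ hmu) fun j hj => ?_
  have := dvd_trans (Dvd.intro k rfl) hj
  omega

/-- There are generic parameters arbitrarily close to `1 / N`, for instance `1 / N + i s` with
`s > 0`. -/
instance genericLimit_neBot (N : ℕ) : (genericLimit N).NeBot := by
  have h : Tendsto (fun s : ℝ => rootParam N + Complex.I * s) (𝓝[>] 0) (genericLimit N) := by
    refine tendsto_nhdsWithin_iff.2 ⟨?_, ?_⟩
    · have hc : Continuous fun s : ℝ => rootParam N + Complex.I * s := by fun_prop
      have := (hc.tendsto 0).mono_left (nhdsWithin_le_nhds (s := Set.Ioi 0))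
      simpa using this
    · filter_upwards [self_mem_nhdsWithin] with s hs m hm h1
      have hs : 0 < s := hs
      have h2 := congrArg norm h1
      rw [norm_pow, norm_one, pow_eq_one_iff_of_nonneg (norm_nonneg _) hm.ne', qpow,
        Complex.norm_exp, Real.exp_eq_one_iff] at h2
      have h3 : (2 * Real.pi * Complex.I * (rootParam N + Complex.I * s) * (1 : ℝ)).re =
          -(2 * Real.pi * s) := by
        have : rootParam N = (((1 / N : ℝ)) : ℂ) := by rw [rootParam]; push_cast; rfl
        rw [this]
        simp
      rw [h3] at h2
      have : 0 < 2 * Real.pi * s := by positivity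
      linarith
  exact h.neBot

theorem tendsto_sch {N n : ℕ} (lam : Weight n) {mu : Weight n} (h : QDen (rootParam N) mu ≠ 0) :
    Tendsto (fun t => sch t lam mu) (genericLimit N) (𝓝 (sch (rootParam N) lam mu)) := by
  have hS : Continuous fun t => SMat t lam mu := by
    unfold SMat SPrime
    exact continuous_const.mul (continuous_finsetSum _ fun w _ =>
      continuous_const.mul (continuous_qpow _))
  have hQ : Continuous fun t => QDen t mu := by
    unfold QDen
    exact continuous_finsetSum _ fun w _ => continuous_const.mul (continuous_qpow _)
  exact (hS.continuousAt.div hQ.continuousAt h).tendsto.mono_left nhdsWithin_le_nhds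

theorem chiC_eq_sch {N n : ℕ} (lam : Weight n) {mu : Weight n} (h : QDen (rootParam N) mu ≠ 0) :
    chiC N lam mu = sch (rootParam N) lam mu := (tendsto_sch lam h).limUnder_eq

theorem sdim_eq_sch {N n : ℕ} (lam : Weight n) (h : QDen (rootParam N) (0 : Weight n) ≠ 0) :
    sdim N lam = sch (rootParam N) lam 0 := (tendsto_sch lam h).limUnder_eq

/-! ### Condition (iv) -/

theorem parSign_mul_self {n : ℕ} (lam : Weight n) : parSign lam * parSign lam = 1 := by
  rw [parSign, ← mul_pow]; simp

theorem SPrime_zero_left {n : ℕ} (t : ℂ) (mu : Weight n) : SPrime t 0 mu = QDen t mu := by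
  rw [SPrime_eq_det, QDen_eq_det]; simp

theorem qpow_two_rho_rho (t : ℂ) (n : ℕ) :
    qpow t (((2 : ℝ) • rho n) ⬝ᵥ rho n) = (∏ i, qpow t (rho n i ^ 2)) ^ 2 := by
  rw [← qpow_sum, ← qpow_natCast_mul, smul_dotProduct, dotProduct]
  simp [sq]

/-- The matrix whose maximal minors are, up to a Gaussian factor, the `S'_{λ,0}`. -/
noncomputable def gaussCosMatrix (N k n : ℕ) : Matrix (Fin n) (Fin k)ᵒᵈ ℂ :=
  Matrix.of fun j e =>
    qpow (rootParam N) ((((OrderDual.ofDual e : Fin k) : ℕ) + 1 / 2 : ℝ) ^ 2) *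
      cosKer (rootParam N) (((OrderDual.ofDual e : Fin k) : ℕ) + 1 / 2) (rho n j)

/-- The matrix whose maximal minors are the `S'_{λ,μ}`. -/
noncomputable def cosMatrix (N k : ℕ) {n : ℕ} (mu : Weight n) : Matrix (Fin k)ᵒᵈ (Fin n) ℂ :=
  Matrix.of fun e j =>
    cosKer (rootParam N) (((OrderDual.ofDual e : Fin k) : ℕ) + 1 / 2) (mu j + rho n j)

theorem weightOfStrictMono_add_rho {n k : ℕ} (f : {f : Fin n → (Fin k)ᵒᵈ // StrictMono f})
    (i : Fin n) : (weightOfStrictMono f i : ℝ) + rho n i =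
      ((OrderDual.ofDual (f.1 i) : Fin k) : ℕ) + 1 / 2 := by
  rw [add_rho_eq_shifted, shifted_weightOfStrictMono]

theorem det_cosMatrix_submatrix (N k : ℕ) {n : ℕ} (mu : Weight n)
    (f : {f : Fin n → (Fin k)ᵒᵈ // StrictMono f}) :
    ((cosMatrix N k mu).submatrix f.1 id).det =
      SPrime (rootParam N) (weightOfStrictMono f) mu := by
  rw [SPrime_eq_det]
  simp only [weightOfStrictMono_add_rho]
  rfl

theorem det_gaussCosMatrix_submatrix (N k n : ℕ)
    (f : {f : Fin n → (Fin k)ᵒᵈ // StrictMono f}) :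
    ((gaussCosMatrix N k n).submatrix id f.1).det =
      (∏ i, qpow (rootParam N) ((weightOfStrictMono f i + rho n i) ^ 2)) *
        SPrime (rootParam N) (weightOfStrictMono f) 0 := by
  rw [SPrime_eq_det, ← Matrix.det_transpose, ← Matrix.det_mul_column]
  simp only [weightOfStrictMono_add_rho]
  congr 1
  ext i j
  simp [gaussCosMatrix]

theorem det_gaussCos_mul_cos {N k : ℕ} (hN : N = 2 * (2 * k + 1)) {n : ℕ} (mu : Weight n) :
    (gaussCosMatrix N k n * cosMatrix N k mu).det =
      (∏ _i : Fin n, halfGauss N k) * (∏ i, qpow (rootParam N) (rho n i ^ 2))⁻¹ *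
        (∏ i, qpow (rootParam N) ((mu i + rho n i) ^ 2))⁻¹ * QDen (rootParam N) mu := by
  rw [QDen_eq_det, ← Finset.prod_inv_distrib, ← Finset.prod_inv_distrib,
    ← Finset.prod_mul_distrib, mul_assoc, ← Matrix.det_mul_row, ← Matrix.det_mul_column]
  congr 1
  ext i j
  have h := sum_alcove_cosKer hN ((n - 1 - i : ℕ) : ℤ) ((mu j + (n - 1 - j) : ℕ) : ℤ)
  rw [Int.cast_natCast, Int.cast_natCast, ← rho_eq_half_odd, ← weight_add_rho,
    ← Fin.sum_univ_eq_sum_range (fun e : ℕ => qpow (rootParam N) (((e : ℝ) + 1 / 2) ^ 2) *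
        cosKer (rootParam N) (e + 1 / 2) (rho n i) *
        cosKer (rootParam N) (e + 1 / 2) (mu j + rho n j)) k] at h
  simp only [Matrix.of_apply]
  rw [← mul_assoc, ← h, Matrix.mul_apply]
  exact Fintype.sum_equiv OrderDual.ofDual _ _ fun e => rfl

/-- The equation of condition (iv) at `μ`. By the Cauchy–Binet formula the sum over the alcove is
the determinant of the one-dimensional sums `sum_alcove_cosKer`. -/
theorem sum_dConst_eq_chiV {N k n : ℕ} (hN : N = 2 * (2 * k + 1)) {mu : Weight n}
    (hmu : mu ∈ LambdaPlus N n) :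
    ∑ᶠ lam ∈ LambdaPlus N n, dConst N lam * (chiV N lam)⁻¹ * chiC N lam mu = chiV N mu := by
  have hQ := QDen_ne_zero_of_odd hN hmu
  have hQ0 := QDen_ne_zero_of_odd hN (zero_mem_LambdaPlus hN ⟨mu, hmu⟩)
  have hR : (∏ i, qpow (rootParam N) (rho n i ^ 2)) ≠ 0 :=
    Finset.prod_ne_zero_iff.2 fun i _ => qpow_ne_zero _ _
  have hcas : casSum N (N / 2) n ≠ 0 := casSum_half_ne_zero hN n
  have hc := casSum_half_eq_halfGauss hN n
  have hK : (∏ _i : Fin n, halfGauss N k) ≠ 0 := by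
    rw [hc] at hcas
    exact left_ne_zero_of_mul hcas
  rw [← range_weightOfStrictMono hN, finsum_mem_range weightOfStrictMono_injective,
    finsum_eq_sum_of_fintype]
  have hterm : ∀ f : {f : Fin n → (Fin k)ᵒᵈ // StrictMono f},
      dConst N (weightOfStrictMono f) * (chiV N (weightOfStrictMono f))⁻¹ *
        chiC N (weightOfStrictMono f) mu =
      (∏ i, qpow (rootParam N) (rho n i ^ 2)) ^ 2 *
        ((∏ _i : Fin n, halfGauss N k) * QDen (rootParam N) mu)⁻¹ *
        (((gaussCosMatrix N k n).submatrix id f.1).det *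
          ((cosMatrix N k mu).submatrix f.1 id).det) := by
    intro f
    have hp := parSign_mul_self (weightOfStrictMono f)
    rw [det_gaussCosMatrix_submatrix, det_cosMatrix_submatrix, dConst, chiC_eq_sch _ hQ,
      sdim_eq_sch _ hQ0, chiV_eq_inv, inv_inv, qCas_eq_prod_sq, hc, qpow_two_rho_rho, gammaDen,
      sch, sch, SMat, SMat]
    field_simp
    rw [sq, hp]
    ring
  simp only [hterm]
  rw [← Finset.mul_sum, ← det_mul_eq_sum_strictMono, det_gaussCos_mul_cos hN, chiV_eq_inv,
    qCas_eq_prod_sq]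
  field_simp

theorem conditionIV_dConst {N k n : ℕ} (hN : N = 2 * (2 * k + 1))
    (h : (LambdaPlus N n).Nonempty) : ConditionIV N n (fun lam => dConst N lam) := by
  have h0 := zero_mem_LambdaPlus hN h
  have hQ0 := QDen_ne_zero_of_odd hN h0
  refine ⟨⟨0, h0, ?_⟩, fun mu hmu => ?_⟩
  · have hs : sdim N (0 : Weight n) = 1 := by
      rw [sdim_eq_sch _ hQ0, sch, SMat, SPrime_zero_left]
      simp [parSign, hQ0]
    simp only [dConst, hs, mul_one]
    exact div_ne_zero (mul_ne_zero (qpow_ne_zero _ _) hQ0) (casSum_half_ne_zero hN n)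
  · rw [sum_dConst_eq_chiV hN hmu, sub_self]

/-! ### The maximal element of the Weyl group -/

theorem Weyl.exists_isMaximal (n : ℕ) : ∃ τ : Weyl n, τ.IsMaximal := by
  have h : ∀ x : HDual n, -Weyl.act ((fun _ => -1, 1) : Weyl n) x = x := by
    intro x; funext i; simp [Weyl.act]
  refine ⟨(fun _ => -1, 1), fun α hα => ?_, fun α hα => ?_⟩ <;> rwa [h]

theorem dotProduct_rho_pos_of_mem_evenRoots {n : ℕ} {α : HDual n} (h : α ∈ evenRoots n) :
    0 < rho n ⬝ᵥ α := by
  have hp : ∀ i : Fin n, 0 < rho n i := fun i => by rw [rho_eq_half_odd]; positivity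
  rcases mem_evenRoots.1 h with ⟨i, j, hij, rfl⟩ | ⟨i, j, hij, rfl⟩ | ⟨i, rfl⟩
  · have : ((i : ℕ) : ℝ) < (j : ℕ) := by exact_mod_cast hij
    rw [dotProduct_sub, dotProduct_eps, dotProduct_eps, rho_apply, rho_apply]
    linarith
  · rw [dotProduct_add, dotProduct_eps, dotProduct_eps]
    exact add_pos (hp i) (hp j)
  · rw [dotProduct_smul, dotProduct_eps]
    exact mul_pos two_pos (hp i)

/-- The maximal element of the Weyl group of `osp(1|2n)` is `-1`. -/
theorem Weyl.IsMaximal.act_eq_neg {n : ℕ} {τ : Weyl n} (hτ : τ.IsMaximal) (x : HDual n) :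
    τ.act x = -x := by
  obtain ⟨s, π⟩ := τ
  have hs : ∀ i, ((s i : ℤˣ) : ℤ) = -1 := by
    intro i
    obtain ⟨l, hl⟩ := mem_oddRoots.1 (hτ.2 (eps (π⁻¹ i)) (mem_oddRoots.2 ⟨_, rfl⟩))
    have h := congrFun hl i
    rcases Int.units_eq_one_or (s i) with h1 | h1
    · exfalso
      simp only [Weyl.act, Pi.neg_apply, h1, eps, Pi.single_eq_same, Pi.single_apply] at h
      split_ifs at h <;> norm_num at h
    · rw [h1]; rfl
  have hact : ∀ y : HDual n, -Weyl.act (s, π) y = fun i => y (π⁻¹ i) := by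
    intro y; funext i; simp [Weyl.act, hs]
  have hmono : StrictMono π := by
    intro i j hij
    have h1 := hτ.1 _ (mem_evenRoots.2 (Or.inl ⟨i, j, hij, rfl⟩))
    rw [hact] at h1
    have e : (fun l => (eps i - eps j : HDual n) (π⁻¹ l)) = eps (π i) - eps (π j) := by
      funext l
      simp [eps, Pi.single_apply, Equiv.symm_apply_eq]
    rw [e] at h1
    have h2 := dotProduct_rho_pos_of_mem_evenRoots h1
    rw [dotProduct_sub, dotProduct_eps, dotProduct_eps, rho_apply, rho_apply] at h2
    have : (((π i : Fin n) : ℕ) : ℝ) < (π j : Fin n) := by linarith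
    exact_mod_cast this
  have hπ : π = 1 := by
    have : (π : Fin n → Fin n) = id := (hmono.range_inj strictMono_id).1 (by simp)
    ext i
    rw [this]; rfl
  rw [← neg_neg (Weyl.act (s, π) x), hact, hπ]
  rfl

/-! ### The two classes of `N` -/

theorem mainTheorem5 (n : ℕ) (hn : 1 ≤ n) :
    -- The case `N = 2(2k+1)`.
    (∀ k N : ℕ, N = 2 * (2 * k + 1) →
      -- the limits defining `χ_μ(C_λ)` and `sdim_q(V_λ)` exist
      (∀ lam ∈ LambdaPlus N n, ∀ mu ∈ LambdaPlus N n,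
        Tendsto (fun t => sch t lam mu) (genericLimit N) (𝓝 (chiC N lam mu))) ∧
      (∀ lam ∈ LambdaPlus N n,
        Tendsto (fun t => sdimGen t lam) (genericLimit N) (𝓝 (sdim N lam))) ∧
      -- the summand of the denominator is a function on `X_{N/2}`
      (∀ lam lam' : Weight n, (∀ i, lam i ≡ lam' i [MOD N / 2]) →
        qCas N lam = qCas N lam') ∧
      -- the denominator is a nonzero product of quadratic Gauss sums
      casSum N (N / 2) n ≠ 0 ∧
      casSum N (N / 2) n = casSum N N n / 2 ^ n ∧
      casSum N N n = ∏ j ∈ Finset.range n, gaussG N (2 * j + 1) ∧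
      (∃ x : ℂ, IsPrimitiveRoot x (4 * N) ∧ ∀ m : ℕ, Odd m →
        gaussG N m = (1 + Complex.I) * (Real.sqrt N : ℂ) / x ^ (m ^ 2)) ∧
      -- condition (iv) holds with the stated constants
      ((LambdaPlus N n).Nonempty → ConditionIV N n (fun lam => dConst N lam)) ∧
      -- `d_{λ^*} = d_λ` for `λ^* = -τ(λ)`
      (∃ τ : Weyl n, τ.IsMaximal) ∧
      (∀ τ : Weyl n, τ.IsMaximal → ∀ lam ∈ LambdaPlus N n,
        ∃ lam' ∈ LambdaPlus N n, lam'.toH = -τ.act lam.toH ∧ dConst N lam' = dConst N lam) ∧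
      -- `x_λ = c q^{-(λ, 2ρ)}` works with `c⁻¹ = ∑_{X_N} q^{(λ, λ + 2ρ)}`
      (∀ mu ∈ LambdaPlus N n, UnfoldedSolves N (casSum N N n)⁻¹ mu)) ∧
    -- The case `N ≡ 0 (mod 4)`: the same choice fails.
    (∀ k N : ℕ, 1 ≤ k → N = 4 * k →
      (∀ (lam : Weight n) (i : Fin n), qCas N (lam + Pi.single i (N / 2)) = -qCas N lam) ∧
      casSum N N n = 0 ∧
      casSum N (N / 2) n = 0 ∧
      (∀ mu ∈ LambdaPlus N n, ∀ c : ℂ, ¬ UnfoldedSolves N c mu)) := by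
  refine ⟨fun k N hN => ⟨?_, ?_, ?_, ?_, ?_, ?_, ?_, ?_, ?_, ?_, ?_⟩, fun k N hk hN => ?_⟩
  · intro lam _ mu hmu
    have hQ := QDen_ne_zero_of_odd hN hmu
    rw [chiC_eq_sch lam hQ]
    exact tendsto_sch lam hQ
  · intro lam hlam
    have hQ := QDen_ne_zero_of_odd hN (zero_mem_LambdaPlus hN ⟨lam, hlam⟩)
    rw [sdim_eq_sch lam hQ]
    exact tendsto_sch lam hQ
  · exact fun lam lam' h => qCas_congr_half hN h
  · exact casSum_half_ne_zero hN n
  · exact casSum_half_of_odd hN n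
  · exact casSum_self_eq_prod_range N n
  · exact gaussG_eq_primitiveRoot hN
  · exact conditionIV_dConst hN
  · exact Weyl.exists_isMaximal n
  · exact fun τ hτ lam hlam => ⟨lam, hlam, by rw [hτ.act_eq_neg, neg_neg], rfl⟩
  · exact fun mu _ => unfoldedSolves_of_odd hN mu
  · subst hN
    exact ⟨fun lam i => qCas_add_single_of_four_dvd hk lam i, casSum_eq_zero_of_four_dvd hk hn,
      casSum_half_eq_zero_of_four_dvd hk hn, fun mu hmu c =>
        not_unfoldedSolves_of_four_dvd hk hn (QDen_ne_zero_of_four_dvd hk hmu) c⟩
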